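/- A straight line program (SLP) of size $n \ge 1$ over an integer alphabet is a sequence of assignments $X_i \to \mathit{expr}_i$ ($1 \le i \le n$), where each $\mathit{expr}_i$ is either a letter or a product $X_\ell X_r$ with $\ell, r < i$; it represents the string derived from $X_n$. The Bisection grammar of a non-empty string $S$ is the following SLP, unique up to the order of its assignments. Starting with $S$, every string $X$ with $|X| \ge 2$ that appears is cut into $X = YZ$ with $|Y| = 2^k$, where $k$ is the largest integer with $2^k < |X|$, and the construction is continued recursively with $Y$ and $Z$. There is exactly one variable for each distinct string that appears; equal strings share a variable. The variable of $X = YZ$ has the rule $X \to YZ$, and the variable of a string of length $1$ has that letter as its right-hand side. The size of a grammar is its number of assignments. Theorem (SLP to Bisection). There is a deterministic algorithm which, given an arbitrary SLP of size $n$ that represents a string $S$, outputs the Bisection grammar of $S$, as an SLP, in $O(n^3 m^2)$ time, where $m$ is the size of the Bisection grammar. Here time is the number of unit-cost steps of a word RAM (arithmetic, comparison and memory access on $w$-bit words); the letters are words, and the word size satisfies $w \ge c \log_2 (n + |S|)$ for some absolute constant $c$. The program, $c$ and the constant hidden in $O(\cdot)$ do not depend on the SLP or on $w$. -/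

import Mathlib

/-- The right-hand side of an assignment of a straight line program for the `i`-th variable
(counted from `0`): a letter, or a pair of earlier variables. -/
inductive SLPExpr (α : Type*) (i : ℕ) where
  | letter (a : α) : SLPExpr α i
  | pair (l r : Fin i) : SLPExpr α i

/-- A straight line program: a non-empty sequence of assignments `X_i → expr_i`.
`size` is the number of assignments. -/
structure SLP (α : Type*) where
  size : ℕ
  size_pos : 0 < size
  rule : (i : Fin size) → SLPExpr α i.val

namespace SLP

variable {α : Type*}

/-- An earlier variable, as a variable. -/
def child (G : SLP α) (i : Fin G.size) (l : Fin i.val) : Fin G.size :=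
  ⟨l.val, l.isLt.trans i.isLt⟩

/-- The string derived from the `i`-th variable. -/
def val (G : SLP α) (i : Fin G.size) : List α :=
  match G.rule i with
  | .letter a => [a]
  | .pair l r => G.val (G.child i l) ++ G.val (G.child i r)
termination_by i.val
decreasing_by
  · exact l.isLt
  · exact r.isLt

/-- The last variable. -/
def last (G : SLP α) : Fin G.size := ⟨G.size - 1, Nat.sub_lt G.size_pos Nat.one_pos⟩

/-- The string that the straight line program represents. -/
def string (G : SLP α) : List α := G.val G.last

/-- The three words that describe an assignment: `0, a, 0` for a letter `a`, and `1, l, r` for a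
pair of variables. -/
def encodeExpr {i : ℕ} : SLPExpr ℕ i → List ℕ
  | .letter a => [0, a, 0]
  | .pair l r => [1, l.val, r.val]

/-- A straight line program over an integer alphabet as a sequence of `3 * size + 1` words: the
number of assignments, followed by the assignments in order. -/
def encode (G : SLP ℕ) : List ℕ :=
  G.size :: (List.finRange G.size).flatMap fun i => encodeExpr (G.rule i)

end SLP

/-- The length `2 ^ k` of the left part of a string of length `L ≥ 2` in the Bisection algorithm,
where `k` is the largest integer with `2 ^ k < L`. -/
def bisectionSplit (L : ℕ) : ℕ := 2 ^ Nat.log 2 (L - 1)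

theorem bisectionSplit_spec {L : ℕ} (hL : 2 ≤ L) :
    ∃ k, IsGreatest {k : ℕ | 2 ^ k < L} k ∧ bisectionSplit L = 2 ^ k := by
  refine ⟨Nat.log 2 (L - 1), ⟨?_, fun j hj => ?_⟩, rfl⟩
  · have := Nat.pow_log_le_self 2 (x := L - 1) (by omega)
    change 2 ^ Nat.log 2 (L - 1) < L
    omega
  · have hj' : 2 ^ j < L := hj
    exact Nat.le_log_of_pow_le (by norm_num) (by omega)

/-- `BisectionPart S u`: the substring `u` appears in the recursive construction that the Bisection
algorithm performs on `S`. -/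
inductive BisectionPart {α : Type*} (S : List α) : List α → Prop
  | root : BisectionPart S S
  | left {u : List α} : BisectionPart S u → 2 ≤ u.length →
      BisectionPart S (u.take (bisectionSplit u.length))
  | right {u : List α} : BisectionPart S u → 2 ≤ u.length →
      BisectionPart S (u.drop (bisectionSplit u.length))

/-- `T` is the grammar that the Bisection algorithm produces from `S` (which determines it up to
the order of the assignments): it represents `S`, it has exactly one variable for each string that
appears in the construction and no others, and the rule of a variable `X` with `|X| ≥ 2` is
`X → YZ` with `|Y| = 2 ^ k`, where `k` is the largest integer with `2 ^ k < |X|`.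
(The rule of a variable with `|X| = 1` is necessarily a letter.) -/
structure IsBisectionGrammar {α : Type*} (S : List α) (T : SLP α) : Prop where
  represents : T.string = S
  injective : Function.Injective T.val
  range_val : Set.range T.val = {u | BisectionPart S u}
  length_left : ∀ (i : Fin T.size) (l r : Fin i.val), T.rule i = .pair l r →
    (T.val (T.child i l)).length = bisectionSplit (T.val i).length

/-! ### Word RAM with `w`-bit words and unit cost -/

namespace WordRAM

/-- The unit-cost operations on words. -/
inductive Op where
  | add | sub | mul | div | mod | lt | eq

/-- Addition and multiplication are modulo `2 ^ w`, subtraction is truncated at `0`, and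
comparisons yield `0` or `1`. -/
def Op.eval (w : ℕ) : Op → ℕ → ℕ → ℕ
  | .add, a, b => (a + b) % 2 ^ w
  | .sub, a, b => a - b
  | .mul, a, b => (a * b) % 2 ^ w
  | .div, a, b => a / b
  | .mod, a, b => a % b
  | .lt, a, b => if a < b then 1 else 0
  | .eq, a, b => if a = b then 1 else 0

/-- Expressions: constants, registers, memory cells with a computed address, and operations. -/
inductive Expr where
  | const (k : ℕ)
  | reg (x : ℕ)
  | load (addr : Expr)
  | op (o : Op) (e₁ e₂ : Expr)

/-- A state: the registers, the random access memory, and the output written so far. -/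
structure State where
  reg : ℕ → ℕ
  mem : ℕ → ℕ
  out : List ℕ

def Expr.eval (w : ℕ) (σ : State) : Expr → ℕ
  | .const k => k % 2 ^ w
  | .reg x => σ.reg x
  | .load e => σ.mem (e.eval w σ)
  | .op o e₁ e₂ => o.eval w (e₁.eval w σ) (e₂.eval w σ)

/-- The time to evaluate an expression: one step for each node. -/
def Expr.cost : Expr → ℕ
  | .const _ => 1
  | .reg _ => 1
  | .load e => e.cost + 1
  | .op _ e₁ e₂ => e₁.cost + e₂.cost + 1

/-- Programs; `loop e p` repeats `p` while `e` is nonzero. A program mentions only finitely many registers, and neither they nor its constants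
depend on the input or on the word size. -/
inductive Program where
  | skip
  | assign (x : ℕ) (e : Expr)
  | store (addr e : Expr)
  | emit (e : Expr)
  | seq (p q : Program)
  | ite (e : Expr) (p q : Program)
  | loop (e : Expr) (p : Program)

/-- `Exec w p σ t σ'`: with `w`-bit words, the program `p`, started in the state `σ`, halts in the
state `σ'` after `t` steps. Every elementary command and every test costs one step more than the
expressions that it evaluates. -/
inductive Exec (w : ℕ) : Program → State → ℕ → State → Prop
  | skip (σ : State) : Exec w .skip σ 1 σ
  | assign (x : ℕ) (e : Expr) (σ : State) :
      Exec w (.assign x e) σ (e.cost + 1)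
        { σ with reg := Function.update σ.reg x (e.eval w σ) }
  | store (a e : Expr) (σ : State) :
      Exec w (.store a e) σ (a.cost + e.cost + 1)
        { σ with mem := Function.update σ.mem (a.eval w σ) (e.eval w σ) }
  | emit (e : Expr) (σ : State) :
      Exec w (.emit e) σ (e.cost + 1) { σ with out := σ.out ++ [e.eval w σ] }
  | seq {p q : Program} {σ₁ σ₂ σ₃ : State} {s t : ℕ} :
      Exec w p σ₁ s σ₂ → Exec w q σ₂ t σ₃ → Exec w (.seq p q) σ₁ (s + t) σ₃
  | ite_true {e : Expr} {p q : Program} {σ σ' : State} {t : ℕ} :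
      e.eval w σ ≠ 0 → Exec w p σ t σ' → Exec w (.ite e p q) σ (e.cost + 1 + t) σ'
  | ite_false {e : Expr} {p q : Program} {σ σ' : State} {t : ℕ} :
      e.eval w σ = 0 → Exec w q σ t σ' → Exec w (.ite e p q) σ (e.cost + 1 + t) σ'
  | loop_true {e : Expr} {p : Program} {σ₁ σ₂ σ₃ : State} {s t : ℕ} :
      e.eval w σ₁ ≠ 0 → Exec w p σ₁ s σ₂ → Exec w (.loop e p) σ₂ t σ₃ →
      Exec w (.loop e p) σ₁ (e.cost + 1 + s + t) σ₃
  | loop_false {e : Expr} {p : Program} {σ : State} :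
      e.eval w σ = 0 → Exec w (.loop e p) σ (e.cost + 1) σ

/-- The initial state: the input occupies the memory cells from address `0` on; all registers and
all other cells are `0`, and nothing has been written. -/
def initial (input : List ℕ) : State where
  reg := fun _ => 0
  mem := fun i => input.getD i 0
  out := []

/-- With `w`-bit words, the program `p` on the given input halts within `t` steps, having written
the given output. -/
def ComputesWithin (w : ℕ) (p : Program) (input output : List ℕ) (t : ℕ) : Prop :=
  ∃ (s : ℕ) (σ : State), Exec w p (initial input) s σ ∧ s ≤ t ∧ σ.out = output

end WordRAM

/-! Write `n` for the size of the input and `M` for the number of distinct strings in the Bisection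
of `S` (`partCount`). `S` is never written out: its blocks are handled as a position and a length.

A stack holds blocks of the construction that have no variable yet. The top block becomes a variable
once both its halves have one; otherwise a missing half is pushed. Lengths decrease strictly towards
the top, so the stacked blocks and the strings of the `m` existing variables are pairwise distinct
(`Stack.add_le`). Every round raises `2 * m + d` by one, where `d` is the height of the stack, so
there are fewer than `2 * M` rounds.

A round makes at most three lookups, each asking whether a block equals the string of an existing
variable. A search tree on these variables leaves a single candidate (`scan_found`), found in `O(M *
n)` steps. The candidate is compared with the block by descending its own Bisection tree: to the
left if the left part does not occur at its place in `S`, to the right otherwise. Lengths halve, so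
after at most `n` levels one letter decides. A difference there is a mismatch, which later attaches
the new variable to the search tree.

Each level asks whether the string of a variable `u` occurs in `S` at a position `p`. This is
reduced to letters through facts "`v` occurs in the input variable `j` at `q`". A fact is pushed
down the input grammar until the occurrence crosses the cut of `j` (`locate_spec`). Occurrences of
`v` across the same cut start within a window shorter than `v`, so by the periodicity theorem of
Fine and Wilf any conjunction of them amounts to one arithmetic progression (`occProg_insert`), and
one table entry per pair `(v, j)` suffices. Conversely, a progression follows from three occurrences
(`occProg_iff_three`), and each of these splits into occurrences of the two children of `v`.
Treating `v` in decreasing order ends at letters. With `O(M * n)` entries and `O(n)` steps for each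
descent and each gcd, a test takes `O(M * n ^ 2)` steps, a lookup `O(M * n ^ 3)`, and everything
`O(n ^ 3 * M ^ 2)`.

The programs are verified over natural numbers and translated to the word RAM without changing the
step count (`exec_compile`). Registers are numbered by call depth, so that a routine preserves those
of its callers (`Frame`). -/

namespace BisectionRAM

/-! ### Occurrences and periods of strings -/

section Strings

variable {α : Type*}

/-- The string `v` occurs in `x` at position `p`. -/
def Occ (v x : List α) (p : ℕ) : Prop := ∀ k < v.length, x[p + k]? = v[k]?

theorem occ_append {y z x : List α} {p : ℕ} :
    Occ (y ++ z) x p ↔ Occ y x p ∧ Occ z x (p + y.length) := by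
  constructor
  · intro h
    refine ⟨fun k hk => ?_, fun k hk => ?_⟩
    · rw [h k (by simp; omega), List.getElem?_append_left hk]
    · have := h (y.length + k) (by simp; omega)
      rw [List.getElem?_append_right (by omega)] at this
      simpa [Nat.add_assoc] using this
  · rintro ⟨h1, h2⟩ k hk
    rcases lt_or_ge k y.length with h | h
    · rw [h1 k h, List.getElem?_append_left h]
    · have := h2 (k - y.length) (by simp at hk; omega)
      rw [List.getElem?_append_right h, ← this]
      congr 1; omega

theorem occ_append_left {v a b : List α} {p : ℕ} (h : p + v.length ≤ a.length) :
    Occ v (a ++ b) p ↔ Occ v a p := by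
  refine forall₂_congr fun k hk => ?_
  rw [List.getElem?_append_left (by omega)]

theorem occ_append_right {v a b : List α} {p : ℕ} (h : a.length ≤ p) :
    Occ v (a ++ b) p ↔ Occ v b (p - a.length) := by
  refine forall₂_congr fun k hk => ?_
  rw [List.getElem?_append_right (by omega), Nat.sub_add_comm h]

theorem occ_singleton {a : α} {x : List α} {p : ℕ} : Occ [a] x p ↔ x[p]? = some a := by
  simp [Occ]

/-- The block of length `l` of `x` at position `p`. -/
def block (x : List α) (p l : ℕ) : List α := (x.drop p).take l

theorem block_length {x : List α} {p l : ℕ} (h : p + l ≤ x.length) : (block x p l).length = l := by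
  simp [block]; omega

theorem block_getElem? {x : List α} {p l k : ℕ} (h : k < l) : (block x p l)[k]? = x[p + k]? := by
  simp [block, h]

theorem occ_iff_block {v x : List α} {p : ℕ} (h : p + v.length ≤ x.length) :
    Occ v x p ↔ v = block x p v.length := by
  constructor
  · intro hv
    refine List.ext_getElem? fun k => ?_
    rcases lt_or_ge k v.length with hk | hk
    · rw [block_getElem? hk, hv k hk]
    · rw [List.getElem?_eq_none hk, List.getElem?_eq_none (by rw [block_length h]; exact hk)]
  · intro hv k hk
    conv_rhs => rw [hv]
    rw [block_getElem? hk]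

theorem block_split {x : List α} {p s l : ℕ} (hs : s ≤ l) :
    block x p l = block x p s ++ block x (p + s) (l - s) := by
  have : l = s + (l - s) := by omega
  conv_lhs => rw [this]
  simp only [block]
  rw [List.take_add, List.drop_drop]

theorem block_take {x : List α} {p s l : ℕ} (hs : s ≤ l) :
    (block x p l).take s = block x p s := by
  simp [block, List.take_take, hs]

theorem block_drop {x : List α} {p s l : ℕ} :
    (block x p l).drop s = block x (p + s) (l - s) := by
  simp [block, List.drop_take]

theorem hasPeriod_iff {v : List α} {g : ℕ} :
    List.HasPeriod v g ↔ ∀ k, k + g < v.length → v[k]? = v[k + g]? := by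
  rw [List.hasPeriod_iff_getElem?]
  exact ⟨fun h k hk => h k (by omega), fun h k hk => h k (by omega)⟩

theorem hasPeriod_mul {v : List α} {g : ℕ} (h : List.HasPeriod v g) (t : ℕ) :
    List.HasPeriod v (g * t) := by
  rw [hasPeriod_iff] at *
  induction t with
  | zero => simp
  | succ t ih =>
    intro k hk
    rw [Nat.mul_succ] at hk ⊢
    rw [ih k (by omega), h _ (by omega)]
    congr 1; omega

theorem hasPeriod_of_dvd {v : List α} {g e : ℕ} (h : List.HasPeriod v g) (he : g ∣ e) :
    List.HasPeriod v e := by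
  obtain ⟨t, rfl⟩ := he
  exact hasPeriod_mul h t

/-- Two overlapping occurrences give a period. -/
theorem hasPeriod_of_occ {v x : List α} {p e : ℕ} (h1 : Occ v x p) (h2 : Occ v x (p + e)) :
    List.HasPeriod v e := by
  rw [hasPeriod_iff]
  intro k hk
  rw [← h1 (k + e) hk, ← h2 k (by omega)]
  congr 1; omega

/-- Between two occurrences at a distance that is a multiple of the period, the string occurs
everywhere in the arithmetic progression. -/
theorem occ_between {v x : List α} {lo hi g e : ℕ} (h1 : Occ v x lo) (h2 : Occ v x hi)
    (hg : List.HasPeriod v g) (hd : g ∣ hi - lo) (hw : hi < lo + v.length) (he : g ∣ e)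
    (hle : lo + e ≤ hi) : Occ v x (lo + e) := by
  intro k hk
  have pe := hasPeriod_iff.1 (hasPeriod_of_dvd hg he)
  -- The occurrences at `lo` and `hi` overlap, so each letter of the new occurrence lies in one of
  -- them; the period carries it to the right index of `v`.
  rcases lt_or_ge (e + k) v.length with h | h
  · have := h1 (e + k) h
    rw [pe k (by omega), Nat.add_comm k e, ← this]
    congr 1; omega
  · have hdd : g ∣ hi - lo - e := Nat.dvd_sub hd he
    have pd := hasPeriod_iff.1 (hasPeriod_of_dvd hg hdd)
    have := h2 (k - (hi - lo - e)) (by omega)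
    have h3 := pd (k - (hi - lo - e)) (by omega)
    rw [show k - (hi - lo - e) + (hi - lo - e) = k by omega] at h3
    rw [← h3, ← this]
    congr 1; omega

/-- The occurrences of `v` in `x` at `lo`, `lo + g`, …, `hi`, described by those at the ends and a
period. -/
def OccProg (v x : List α) (lo hi g : ℕ) : Prop :=
  Occ v x lo ∧ Occ v x hi ∧ List.HasPeriod v g

/-- Step `0` encodes a single occurrence, since the period `0` is no condition. -/
theorem occProg_single {v x : List α} {p : ℕ} : OccProg v x p p 0 ↔ Occ v x p :=
  ⟨fun h => h.1, fun h => ⟨h, h, List.hasPeriod_zero v⟩⟩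

/-- The overlap of the occurrences at `lo` and `lo + g` gives back the period `g`. For a single
occurrence, with `g = 0`, the three coincide. -/
theorem occProg_iff_three {v x : List α} {lo hi g : ℕ} (hd : g ∣ hi - lo) (hle : lo + g ≤ hi)
    (hw : hi < lo + v.length) :
    OccProg v x lo hi g ↔ Occ v x lo ∧ Occ v x (lo + g) ∧ Occ v x hi :=
  ⟨fun h => ⟨h.1, occ_between h.1 h.2.1 h.2.2 hd hw dvd_rfl hle, h.2.1⟩,
    fun h => ⟨h.1, h.2.2, hasPeriod_of_occ h.1 h.2.1⟩⟩

theorem hasPeriod_gcd_of_le {v : List α} {g e : ℕ} (hg : List.HasPeriod v g)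
    (he : List.HasPeriod v e) (h : g + e ≤ v.length) : List.HasPeriod v (Nat.gcd g e) := by
  refine List.HasPeriod.gcd hg he (by omega)

/-- All occurrences meet within a window shorter than `v`, so the new one overlaps its neighbours in
the progression and yields a second period. That period and `g` (or, inside the progression, the two
distances to the neighbours) sum to at most the length of `v`, and Fine–Wilf gives their gcd.
Conversely, the old progression and `p` are among the terms of the new one. -/
theorem occProg_insert {v x : List α} {lo hi g p : ℕ} (hd : g ∣ hi - lo) (hle : lo + g ≤ hi)
    (hw : hi < lo + v.length) (hp1 : p < lo + v.length) (hp2 : hi < p + v.length) :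
    (OccProg v x lo hi g ∧ Occ v x p) ↔
      OccProg v x (min lo p) (max hi p) (Nat.gcd g ((p - lo) + (lo - p))) := by
  rcases lt_or_ge p lo with hpl | hpl
  · rw [min_eq_right hpl.le, max_eq_left (by omega), Nat.sub_eq_zero_of_le hpl.le, Nat.zero_add]
    constructor
    · rintro ⟨⟨h1, h2, h3⟩, h4⟩
      refine ⟨h4, h2, hasPeriod_gcd_of_le h3 (hasPeriod_of_occ h4 (e := lo - p) ?_) (by omega)⟩
      rwa [Nat.add_sub_cancel' hpl.le]
    · rintro ⟨h1, h2, h3⟩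
      refine ⟨⟨?_, h2, hasPeriod_of_dvd h3 (Nat.gcd_dvd_left _ _)⟩, h1⟩
      have := occ_between h1 h2 h3 (e := lo - p) ?_ hp2 (Nat.gcd_dvd_right _ _) (by omega)
      · rwa [Nat.add_sub_cancel' hpl.le] at this
      · rw [show hi - p = (hi - lo) + (lo - p) by omega]
        exact dvd_add ((Nat.gcd_dvd_left _ _).trans hd) (Nat.gcd_dvd_right _ _)
  rw [min_eq_left hpl, Nat.sub_eq_zero_of_le hpl, Nat.add_zero]
  rcases lt_or_ge hi p with hph | hph
  · rw [max_eq_right hph.le]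
    have e1 : p - lo = (p - hi) + (hi - lo) := by omega
    -- The overlap with the last occurrence gives the period `p - hi`, short enough for Fine–Wilf;
    -- `g ∣ hi - lo` makes the gcd the same as that measured from `lo`.
    have hgcd : Nat.gcd g (p - lo) = Nat.gcd g (p - hi) := by
      obtain ⟨t, ht⟩ := hd
      rw [e1, ht, Nat.gcd_add_mul_left_right]
    have hdd : Nat.gcd g (p - lo) ∣ p - lo := Nat.gcd_dvd_right _ _
    constructor
    · rintro ⟨⟨h1, h2, h3⟩, h4⟩
      refine ⟨h1, h4, ?_⟩
      rw [hgcd]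
      refine hasPeriod_gcd_of_le h3 (hasPeriod_of_occ h2 (e := p - hi) ?_) (by omega)
      rwa [Nat.add_sub_cancel' hph.le]
    · rintro ⟨h1, h2, h3⟩
      have := occ_between h1 h2 h3 hdd hp1 ((Nat.gcd_dvd_left _ _).trans hd) (by omega)
      rw [Nat.add_sub_cancel' (by omega)] at this
      exact ⟨⟨h1, this, hasPeriod_of_dvd h3 (Nat.gcd_dvd_left _ _)⟩, h2⟩
  · rw [max_eq_left hph]
    constructor
    · rintro ⟨⟨h1, h2, h3⟩, h4⟩
      refine ⟨h1, h2, ?_⟩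
      rcases Nat.eq_zero_or_pos g with rfl | hg
      · have : p = lo := by
          have := Nat.eq_zero_of_zero_dvd hd
          omega
        subst this
        simp
      set e := (p - lo) % g with he
      set q := (p - lo) / g with hq
      have hdm : g * q + e = p - lo := Nat.div_add_mod _ _
      have heg : e < g := Nat.mod_lt _ hg
      have hgcd : Nat.gcd g (p - lo) = Nat.gcd g e := by
        rw [← hdm, Nat.add_comm, Nat.gcd_add_mul_left_right]
      rw [hgcd]
      rcases Nat.eq_zero_or_pos e with h0 | h0
      · rw [h0]; simpa using h3
      have hnext : lo + g * (q + 1) ≤ hi := by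
        obtain ⟨t, ht⟩ := hd
        have : q < t := by
          by_contra hh
          have := Nat.mul_le_mul_left g (not_lt.1 hh)
          omega
        have := Nat.mul_le_mul_left g (show q + 1 ≤ t from this)
        omega
      have o1 := occ_between h1 h2 h3 hd hw (Nat.dvd_mul_right g q)
        (by rw [Nat.mul_succ] at hnext; omega)
      have o2 := occ_between h1 h2 h3 hd hw (Nat.dvd_mul_right g (q + 1)) hnext
      rw [Nat.mul_succ] at o2 hnext
      -- Here `p` lies strictly between two consecutive terms, at distances `e` and `g - e`; these
      -- two periods sum to `g`, and their gcd is that of `g` and `e`.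
      have p1 := hasPeriod_of_occ o1 (e := e) (by convert h4 using 1; omega)
      have p2 := hasPeriod_of_occ h4 (e := g - e) (by convert o2 using 1; omega)
      have := hasPeriod_gcd_of_le p2 p1 (by omega)
      rwa [← Nat.gcd_self_add_left, Nat.add_comm, Nat.sub_add_cancel heg.le] at this
    · rintro ⟨h1, h2, h3⟩
      have := occ_between h1 h2 h3 ((Nat.gcd_dvd_left _ _).trans hd) hw
        (Nat.gcd_dvd_right g (p - lo)) (by omega)
      rw [Nat.add_sub_cancel' hpl] at this
      exact ⟨⟨h1, h2, hasPeriod_of_dvd h3 (Nat.gcd_dvd_left _ _)⟩, this⟩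

end Strings

end BisectionRAM

namespace BisectionRAM

/-! ### Programs over registers and sixteen unbounded arrays

The arithmetic of these programs is that of the natural numbers, under side conditions that exclude
overflow. They are compiled to the word RAM, with the arrays interleaved behind the input. -/

/-- `wadd` is the one operation that may wrap around. It serves to compute the lengths of the input
variables, since variables that do not contribute to `S` may derive strings whose length exceeds any
word. -/
inductive HExpr where
  | const (k : ℕ)
  | reg (x : ℕ)
  | size
  | rule (k : ℕ) (e : HExpr)
  | arr (r : ℕ) (e : HExpr)
  | add (a b : HExpr)
  | wadd (a b : HExpr)
  | sub (a b : HExpr)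
  | mul (a b : HExpr)
  | mod (a b : HExpr)
  | div (a b : HExpr)
  | lt (a b : HExpr)
  | eq (a b : HExpr)

instance : Add HExpr := ⟨.add⟩
instance : Sub HExpr := ⟨.sub⟩
instance : Mul HExpr := ⟨.mul⟩
instance (k : ℕ) : OfNat HExpr k := ⟨.const k⟩

inductive HProg where
  | skip
  | assign (x : ℕ) (e : HExpr)
  | store (r : ℕ) (i e : HExpr)
  | emit (e : HExpr)
  | seq (p q : HProg)
  | ite (e : HExpr) (p q : HProg)
  | loop (e : HExpr) (p : HProg)

/-- The sequential composition of a list of programs. -/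
def HProg.list : List HProg → HProg
  | [] => .skip
  | p :: l => .seq p (HProg.list l)

structure St where
  reg : ℕ → ℕ
  arr : ℕ → ℕ → ℕ
  out : List ℕ

namespace St

def set (s : St) (x v : ℕ) : St := { s with reg := fun y => if y = x then v else s.reg y }

def put (s : St) (r i v : ℕ) : St :=
  { s with arr := fun r' i' => if r' = r ∧ i' = i then v else s.arr r' i' }

def write (s : St) (v : ℕ) : St := { s with out := s.out ++ [v] }

@[simp] theorem set_reg (s : St) (x v y : ℕ) :
    (s.set x v).reg y = if y = x then v else s.reg y := rfl
@[simp] theorem set_arr (s : St) (x v : ℕ) : (s.set x v).arr = s.arr := rfl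
@[simp] theorem set_out (s : St) (x v : ℕ) : (s.set x v).out = s.out := rfl
@[simp] theorem put_reg (s : St) (r i v : ℕ) : (s.put r i v).reg = s.reg := rfl
@[simp] theorem put_arr (s : St) (r i v r' i' : ℕ) :
    (s.put r i v).arr r' i' = if r' = r ∧ i' = i then v else s.arr r' i' := rfl
@[simp] theorem put_out (s : St) (r i v : ℕ) : (s.put r i v).out = s.out := rfl
@[simp] theorem write_reg (s : St) (v : ℕ) : (s.write v).reg = s.reg := rfl
@[simp] theorem write_arr (s : St) (v : ℕ) : (s.write v).arr = s.arr := rfl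
@[simp] theorem write_out (s : St) (v : ℕ) : (s.write v).out = s.out ++ [v] := rfl

end St

/-- An input, a word size, and a bound `bd` for the numbers that occur. -/
structure Ctx where
  G : SLP ℕ
  w : ℕ
  bd : ℕ
  fits : 16 * bd + 3 * G.size + 17 ≤ 2 ^ w

/-- The words that describe the `i`-th assignment. -/
def word (G : SLP ℕ) (i k : ℕ) : ℕ := G.encode.getD (3 * i + (k + 1)) 0

variable (c : Ctx) (s : St)

def HExpr.val : HExpr → ℕ
  | .const k => k
  | .reg x => s.reg x
  | .size => c.G.size
  | .rule k e => word c.G e.val k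
  | .arr r e => s.arr r e.val
  | .add a b => a.val + b.val
  | .wadd a b => (a.val + b.val) % 2 ^ c.w
  | .sub a b => a.val - b.val
  | .mul a b => a.val * b.val
  | .mod a b => a.val % b.val
  | .div a b => a.val / b.val
  | .lt a b => if a.val < b.val then 1 else 0
  | .eq a b => if a.val = b.val then 1 else 0

/-- The evaluation causes no overflow. -/
def HExpr.Safe : HExpr → Prop
  | .const k => k ≤ c.bd
  | .reg _ => True
  | .size => True
  | .rule k e => e.Safe ∧ e.val c s < c.G.size ∧ k < 3
  | .arr r e => e.Safe ∧ e.val c s ≤ c.bd ∧ r < 16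
  | .add a b => a.Safe ∧ b.Safe ∧ a.val c s + b.val c s ≤ c.bd
  | .wadd a b => a.Safe ∧ b.Safe
  | .sub a b => a.Safe ∧ b.Safe
  | .mul a b => a.Safe ∧ b.Safe ∧ a.val c s * b.val c s ≤ c.bd
  | .mod a b => a.Safe ∧ b.Safe
  | .div a b => a.Safe ∧ b.Safe
  | .lt a b => a.Safe ∧ b.Safe
  | .eq a b => a.Safe ∧ b.Safe

/-- The surcharges `2`, `5` and `10` are the exact costs of the compiled memory accesses, including
the address computations. -/
def HExpr.cost : HExpr → ℕ
  | .const _ => 1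
  | .reg _ => 1
  | .size => 2
  | .rule _ e => e.cost + 5
  | .arr _ e => e.cost + 10
  | .add a b | .wadd a b | .sub a b | .mul a b | .mod a b | .div a b | .lt a b | .eq a b =>
    a.cost + b.cost + 1

section SimpLemmas

open HExpr

@[simp] theorem val_const (k : ℕ) : (HExpr.const k).val c s = k := rfl
@[simp] theorem val_ofNat (k : ℕ) : (no_index (OfNat.ofNat k) : HExpr).val c s = k := rfl
@[simp] theorem val_reg (x : ℕ) : (HExpr.reg x).val c s = s.reg x := rfl
@[simp] theorem val_size : HExpr.size.val c s = c.G.size := rfl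
@[simp] theorem val_rule (k : ℕ) (e : HExpr) :
    (HExpr.rule k e).val c s = word c.G (e.val c s) k := rfl
@[simp] theorem val_arr (r : ℕ) (e : HExpr) : (HExpr.arr r e).val c s = s.arr r (e.val c s) := rfl
@[simp] theorem val_add (a b : HExpr) : (a + b).val c s = a.val c s + b.val c s := rfl
@[simp] theorem val_wadd (a b : HExpr) :
    (HExpr.wadd a b).val c s = (a.val c s + b.val c s) % 2 ^ c.w := rfl
@[simp] theorem val_sub (a b : HExpr) : (a - b).val c s = a.val c s - b.val c s := rfl
@[simp] theorem val_mul (a b : HExpr) : (a * b).val c s = a.val c s * b.val c s := rfl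
@[simp] theorem val_mod (a b : HExpr) : (HExpr.mod a b).val c s = a.val c s % b.val c s := rfl
@[simp] theorem val_div (a b : HExpr) : (HExpr.div a b).val c s = a.val c s / b.val c s := rfl
@[simp] theorem val_lt (a b : HExpr) :
    (HExpr.lt a b).val c s = if a.val c s < b.val c s then 1 else 0 := rfl
@[simp] theorem val_eq (a b : HExpr) :
    (HExpr.eq a b).val c s = if a.val c s = b.val c s then 1 else 0 := rfl

@[simp] theorem safe_const (k : ℕ) : (HExpr.const k).Safe c s ↔ k ≤ c.bd := Iff.rfl
@[simp] theorem safe_ofNat (k : ℕ) : (no_index (OfNat.ofNat k) : HExpr).Safe c s ↔ k ≤ c.bd :=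
  Iff.rfl
@[simp] theorem safe_reg (x : ℕ) : (HExpr.reg x).Safe c s := trivial
@[simp] theorem safe_size : HExpr.size.Safe c s := trivial
@[simp] theorem safe_rule (k : ℕ) (e : HExpr) :
    (HExpr.rule k e).Safe c s ↔ e.Safe c s ∧ e.val c s < c.G.size ∧ k < 3 := Iff.rfl
@[simp] theorem safe_arr (r : ℕ) (e : HExpr) :
    (HExpr.arr r e).Safe c s ↔ e.Safe c s ∧ e.val c s ≤ c.bd ∧ r < 16 := Iff.rfl
@[simp] theorem safe_add (a b : HExpr) :
    (a + b).Safe c s ↔ a.Safe c s ∧ b.Safe c s ∧ a.val c s + b.val c s ≤ c.bd := Iff.rfl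
@[simp] theorem safe_wadd (a b : HExpr) :
    (HExpr.wadd a b).Safe c s ↔ a.Safe c s ∧ b.Safe c s := Iff.rfl
@[simp] theorem safe_sub (a b : HExpr) : (a - b).Safe c s ↔ a.Safe c s ∧ b.Safe c s := Iff.rfl
@[simp] theorem safe_mul (a b : HExpr) :
    (a * b).Safe c s ↔ a.Safe c s ∧ b.Safe c s ∧ a.val c s * b.val c s ≤ c.bd := Iff.rfl
@[simp] theorem safe_mod (a b : HExpr) :
    (HExpr.mod a b).Safe c s ↔ a.Safe c s ∧ b.Safe c s := Iff.rfl
@[simp] theorem safe_div (a b : HExpr) :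
    (HExpr.div a b).Safe c s ↔ a.Safe c s ∧ b.Safe c s := Iff.rfl
@[simp] theorem safe_lt (a b : HExpr) :
    (HExpr.lt a b).Safe c s ↔ a.Safe c s ∧ b.Safe c s := Iff.rfl
@[simp] theorem safe_eq (a b : HExpr) :
    (HExpr.eq a b).Safe c s ↔ a.Safe c s ∧ b.Safe c s := Iff.rfl

@[simp] theorem cost_const (k : ℕ) : (HExpr.const k).cost = 1 := rfl
@[simp] theorem cost_ofNat (k : ℕ) : (no_index (OfNat.ofNat k) : HExpr).cost = 1 := rfl
@[simp] theorem cost_reg (x : ℕ) : (HExpr.reg x).cost = 1 := rfl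
@[simp] theorem cost_size : HExpr.size.cost = 2 := rfl
@[simp] theorem cost_rule (k : ℕ) (e : HExpr) : (HExpr.rule k e).cost = e.cost + 5 := rfl
@[simp] theorem cost_arr (r : ℕ) (e : HExpr) : (HExpr.arr r e).cost = e.cost + 10 := rfl
@[simp] theorem cost_add (a b : HExpr) : (a + b).cost = a.cost + b.cost + 1 := rfl
@[simp] theorem cost_wadd (a b : HExpr) : (HExpr.wadd a b).cost = a.cost + b.cost + 1 := rfl
@[simp] theorem cost_sub (a b : HExpr) : (a - b).cost = a.cost + b.cost + 1 := rfl
@[simp] theorem cost_mul (a b : HExpr) : (a * b).cost = a.cost + b.cost + 1 := rfl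
@[simp] theorem cost_mod (a b : HExpr) : (HExpr.mod a b).cost = a.cost + b.cost + 1 := rfl
@[simp] theorem cost_div (a b : HExpr) : (HExpr.div a b).cost = a.cost + b.cost + 1 := rfl
@[simp] theorem cost_lt (a b : HExpr) : (HExpr.lt a b).cost = a.cost + b.cost + 1 := rfl
@[simp] theorem cost_eq (a b : HExpr) : (HExpr.eq a b).cost = a.cost + b.cost + 1 := rfl

end SimpLemmas

/-! ### Executions with step counts, and rules for reasoning about them -/

/-- `HExec c p s k s'`: the program `p`, started in `s`, halts in `s'` after `k` steps, without
overflow. -/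
inductive HExec : HProg → St → ℕ → St → Prop
  | skip (s : St) : HExec .skip s 1 s
  | assign {x : ℕ} {e : HExpr} {s : St} : e.Safe c s →
      HExec (.assign x e) s (e.cost + 1) (s.set x (e.val c s))
  | store {r : ℕ} {i e : HExpr} {s : St} : r < 16 → i.Safe c s → i.val c s ≤ c.bd → e.Safe c s →
      HExec (.store r i e) s (i.cost + e.cost + 10) (s.put r (i.val c s) (e.val c s))
  | emit {e : HExpr} {s : St} : e.Safe c s →
      HExec (.emit e) s (e.cost + 1) (s.write (e.val c s))
  | seq {p q : HProg} {s₁ s₂ s₃ : St} {k t : ℕ} :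
      HExec p s₁ k s₂ → HExec q s₂ t s₃ → HExec (.seq p q) s₁ (k + t) s₃
  | ite_true {e : HExpr} {p q : HProg} {s s' : St} {t : ℕ} : e.Safe c s →
      e.val c s ≠ 0 → HExec p s t s' → HExec (.ite e p q) s (e.cost + 1 + t) s'
  | ite_false {e : HExpr} {p q : HProg} {s s' : St} {t : ℕ} : e.Safe c s →
      e.val c s = 0 → HExec q s t s' → HExec (.ite e p q) s (e.cost + 1 + t) s'
  | loop_true {e : HExpr} {p : HProg} {s₁ s₂ s₃ : St} {k t : ℕ} : e.Safe c s₁ →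
      e.val c s₁ ≠ 0 → HExec p s₁ k s₂ → HExec (.loop e p) s₂ t s₃ →
      HExec (.loop e p) s₁ (e.cost + 1 + k + t) s₃
  | loop_false {e : HExpr} {p : HProg} {s : St} : e.Safe c s →
      e.val c s = 0 → HExec (.loop e p) s (e.cost + 1) s

/-- The program halts, and the number of steps and the final state satisfy `Q`. -/
def Run (p : HProg) (s : St) (Q : ℕ → St → Prop) : Prop := ∃ k s', HExec c p s k s' ∧ Q k s'

variable {c s}

theorem Run.mono {p : HProg} {Q R : ℕ → St → Prop} (h : Run c p s Q)
    (hQ : ∀ k s', Q k s' → R k s') : Run c p s R := by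
  obtain ⟨k, s', h1, h2⟩ := h
  exact ⟨k, s', h1, hQ k s' h2⟩

-- This and the following equivalences act as a weakest-precondition calculus: `simp` reduces a
-- program without loops to claims about its final state and step count.
@[simp] theorem run_skip {Q : ℕ → St → Prop} : Run c .skip s Q ↔ Q 1 s :=
  ⟨fun ⟨_, _, h, hq⟩ => by cases h; exact hq, fun h => ⟨_, _, .skip _, h⟩⟩

@[simp] theorem run_assign {x : ℕ} {e : HExpr} {Q : ℕ → St → Prop} :
    Run c (.assign x e) s Q ↔ e.Safe c s ∧ Q (e.cost + 1) (s.set x (e.val c s)) :=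
  ⟨fun ⟨_, _, h, hq⟩ => by cases h with | assign h => exact ⟨h, hq⟩,
    fun h => ⟨_, _, .assign h.1, h.2⟩⟩

@[simp] theorem run_store {r : ℕ} {i e : HExpr} {Q : ℕ → St → Prop} :
    Run c (.store r i e) s Q ↔ (r < 16 ∧ i.Safe c s ∧ i.val c s ≤ c.bd ∧ e.Safe c s) ∧
      Q (i.cost + e.cost + 10) (s.put r (i.val c s) (e.val c s)) :=
  ⟨fun ⟨_, _, h, hq⟩ => by cases h with | store h1 h2 h3 h4 => exact ⟨⟨h1, h2, h3, h4⟩, hq⟩,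
    fun ⟨⟨h1, h2, h3, h4⟩, h⟩ => ⟨_, _, .store h1 h2 h3 h4, h⟩⟩

@[simp] theorem run_emit {e : HExpr} {Q : ℕ → St → Prop} :
    Run c (.emit e) s Q ↔ e.Safe c s ∧ Q (e.cost + 1) (s.write (e.val c s)) :=
  ⟨fun ⟨_, _, h, hq⟩ => by cases h with | emit h => exact ⟨h, hq⟩,
    fun h => ⟨_, _, .emit h.1, h.2⟩⟩

@[simp] theorem run_seq {p q : HProg} {Q : ℕ → St → Prop} :
    Run c (.seq p q) s Q ↔ Run c p s fun k s' => Run c q s' fun l s'' => Q (k + l) s'' :=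
  ⟨fun ⟨_, _, h, hq⟩ => by cases h with | seq h1 h2 => exact ⟨_, _, h1, _, _, h2, hq⟩,
    fun ⟨_, _, h1, _, _, h2, hq⟩ => ⟨_, _, .seq h1 h2, hq⟩⟩

@[simp] theorem run_ite {e : HExpr} {p q : HProg} {Q : ℕ → St → Prop} :
    Run c (.ite e p q) s Q ↔ e.Safe c s ∧
      (e.val c s ≠ 0 → Run c p s fun k s' => Q (e.cost + 1 + k) s') ∧
      (e.val c s = 0 → Run c q s fun k s' => Q (e.cost + 1 + k) s') := by
  constructor
  · rintro ⟨_, _, h, hq⟩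
    cases h with
    | ite_true h0 h1 h2 => exact ⟨h0, fun _ => ⟨_, _, h2, hq⟩, fun h => (h1 h).elim⟩
    | ite_false h0 h1 h2 => exact ⟨h0, fun h => (h h1).elim, fun _ => ⟨_, _, h2, hq⟩⟩
  · rintro ⟨h0, h1, h2⟩
    by_cases h : e.val c s = 0
    · obtain ⟨_, _, h3, h4⟩ := h2 h
      exact ⟨_, _, .ite_false h0 h h3, h4⟩
    · obtain ⟨_, _, h3, h4⟩ := h1 h
      exact ⟨_, _, .ite_true h0 h h3, h4⟩

@[simp] theorem run_nil {Q : ℕ → St → Prop} : Run c (.list []) s Q ↔ Q 1 s := run_skip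

@[simp] theorem run_cons {p : HProg} {l : List HProg} {Q : ℕ → St → Prop} :
    Run c (.list (p :: l)) s Q ↔
      Run c p s fun k s' => Run c (.list l) s' fun l s'' => Q (k + l) s'' := run_seq

/-- The rule for loops: the index of the invariant decreases, and each round takes at most `B`
steps. -/
theorem run_loop {e : HExpr} {p : HProg} {Q : ℕ → St → Prop} (I : ℕ → St → Prop) (B : ℕ) {i : ℕ}
    (h : I i s)
    (step : ∀ i s, I i s → e.Safe c s ∧ (e.val c s ≠ 0 →
      Run c p s fun k s' => k + e.cost + 1 ≤ B ∧ ∃ i' < i, I i' s'))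
    (done : ∀ j k s', j ≤ i → I j s' → e.val c s' = 0 → k ≤ i * B + (e.cost + 1) → Q k s') :
    Run c (.loop e p) s Q := by
  induction i using Nat.strong_induction_on generalizing s Q with
  | _ i ih =>
    obtain ⟨hs, hstep⟩ := step i s h
    by_cases h0 : e.val c s = 0
    · exact ⟨_, _, .loop_false hs h0, done i _ s le_rfl h h0 (by omega)⟩
    · obtain ⟨k, s', hk, hB, i', hi', hI⟩ := hstep h0
      obtain ⟨k2, s2, h2, hQ⟩ := ih i' hi' (Q := fun k2 s2 => Q (e.cost + 1 + k + k2) s2) hI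
        (fun j k2 s2 hj hI2 he2 hk2 => done j _ s2 (by omega) hI2 he2 (by
          have := Nat.mul_le_mul_right B hi'
          rw [Nat.succ_mul] at this
          omega))
      exact ⟨_, _, .loop_true hs h0 hk h2, hQ⟩

/-! ### Compilation -/

open WordRAM

/-- The address of the cell of index `e` of the array `r`. -/
def addr (r : ℕ) (e : Expr) : Expr :=
  .op .add (.op .add (.op .mul (.const 3) (.load (.const 0))) (.const (r + 1)))
    (.op .mul (.const 16) e)

def HExpr.compile : HExpr → Expr
  | .const k => .const k
  | .reg x => .reg x
  | .size => .load (.const 0)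
  | .rule k e => .load (.op .add (.op .mul (.const 3) e.compile) (.const (k + 1)))
  | .arr r e => .load (addr r e.compile)
  | .add a b => .op .add a.compile b.compile
  | .wadd a b => .op .add a.compile b.compile
  | .sub a b => .op .sub a.compile b.compile
  | .mul a b => .op .mul a.compile b.compile
  | .mod a b => .op .mod a.compile b.compile
  | .div a b => .op .div a.compile b.compile
  | .lt a b => .op .lt a.compile b.compile
  | .eq a b => .op .eq a.compile b.compile

def HProg.compile : HProg → Program
  | .skip => .skip
  | .assign x e => .assign x e.compile
  | .store r i e => .store (addr r i.compile) e.compile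
  | .emit e => .emit e.compile
  | .seq p q => .seq p.compile q.compile
  | .ite e p q => .ite e.compile p.compile q.compile
  | .loop e p => .loop e.compile p.compile

/-- The RAM state that represents a state: the cell of index `i` of the array `r` has the address
`3 * n + 1 + 16 * i + r`. -/
def St.toState (c : Ctx) (s : St) : State where
  reg := s.reg
  mem a := if a < 3 * c.G.size + 1 then c.G.encode.getD a 0 else
    s.arr ((a - (3 * c.G.size + 1)) % 16) ((a - (3 * c.G.size + 1)) / 16)
  out := s.out

theorem cost_compile (e : HExpr) : e.compile.cost = e.cost := by
  induction e <;> simp_all [HExpr.compile, HExpr.cost, Expr.cost, addr] <;> omega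

theorem eval_size : (Expr.load (.const 0)).eval c.w (s.toState c) = c.G.size := by
  simp [Expr.eval, St.toState, SLP.encode]

/-- The largest possible address is `3 * n + 16 * bd + 16`, which `Ctx.fits` keeps below `2 ^ w`; so
no reduction modulo `2 ^ w` has an effect. -/
theorem eval_addr {e : Expr} {r i : ℕ} (he : e.eval c.w (s.toState c) = i) (hi : i ≤ c.bd)
    (hr : r < 16) :
    (addr r e).eval c.w (s.toState c) = 3 * c.G.size + 1 + 16 * i + r := by
  have := c.fits
  have h3 := eval_size (c := c) (s := s)
  change (((3 % 2 ^ c.w * _) % 2 ^ c.w + (r + 1) % 2 ^ c.w) % 2 ^ c.w +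
    (16 % 2 ^ c.w * e.eval c.w (s.toState c)) % 2 ^ c.w) % 2 ^ c.w = _
  rw [h3, he]
  rw [Nat.mod_eq_of_lt (a := 3) (by omega), Nat.mod_eq_of_lt (a := 16) (by omega),
    Nat.mod_eq_of_lt (a := 3 * _) (by omega), Nat.mod_eq_of_lt (a := r + 1) (by omega),
    Nat.mod_eq_of_lt (a := _ + (r + 1)) (by omega), Nat.mod_eq_of_lt (a := 16 * _) (by omega),
    Nat.mod_eq_of_lt (by omega)]
  omega

theorem toState_mem_arr {r i : ℕ} (hr : r < 16) :
    (s.toState c).mem (3 * c.G.size + 1 + 16 * i + r) = s.arr r i := by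
  have h : ¬ (3 * c.G.size + 1 + 16 * i + r < 3 * c.G.size + 1) := by omega
  simp only [St.toState, h, if_false]
  congr 1 <;> omega

theorem eval_compile (e : HExpr) (h : e.Safe c s) :
    e.compile.eval c.w (s.toState c) = e.val c s := by
  have hf := c.fits
  induction e with
  | const k =>
    simp only [HExpr.Safe] at h
    exact Nat.mod_eq_of_lt (by omega)
  | reg x => rfl
  | size => exact eval_size
  | rule k e ih =>
    obtain ⟨h1, h2, h3⟩ := h
    simp only [HExpr.compile, Expr.eval, HExpr.val, Op.eval, ih h1]
    rw [Nat.mod_eq_of_lt (a := 3) (by omega), Nat.mod_eq_of_lt (a := k + 1) (by omega),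
      Nat.mod_eq_of_lt (a := 3 * _) (by omega), Nat.mod_eq_of_lt (by omega)]
    simp only [St.toState]
    rw [if_pos (by omega)]
    rfl
  | arr r e ih =>
    obtain ⟨h1, h2, h3⟩ := h
    simp only [HExpr.compile, Expr.eval, HExpr.val]
    rw [eval_addr (ih h1) h2 h3, toState_mem_arr h3]
  | add a b iha ihb =>
    obtain ⟨h1, h2, h3⟩ := h
    simp only [HExpr.compile, Expr.eval, HExpr.val, Op.eval, iha h1, ihb h2]
    exact Nat.mod_eq_of_lt (by omega)
  | mul a b iha ihb =>
    obtain ⟨h1, h2, h3⟩ := h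
    simp only [HExpr.compile, Expr.eval, HExpr.val, Op.eval, iha h1, ihb h2]
    exact Nat.mod_eq_of_lt (by omega)
  | wadd a b iha ihb | sub a b iha ihb | mod a b iha ihb | div a b iha ihb
  | lt a b iha ihb | eq a b iha ihb =>
    simp only [HExpr.compile, Expr.eval, HExpr.val, Op.eval, iha h.1, ihb h.2]

theorem toState_put {r i v : ℕ} (hr : r < 16) :
    (s.put r i v).toState c = { s.toState c with
      mem := Function.update (s.toState c).mem (3 * c.G.size + 1 + 16 * i + r) v } := by
  simp only [St.toState, St.put, State.mk.injEq, true_and, and_true]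
  funext a
  by_cases h : a = 3 * c.G.size + 1 + 16 * i + r
  · subst h
    rw [Function.update_self, if_neg (by omega), if_pos ⟨by omega, by omega⟩]
  · rw [Function.update_of_ne h]
    split_ifs with h1 h2
    · rfl
    · omega
    · rfl

theorem toState_set {x v : ℕ} :
    (s.set x v).toState c = { s.toState c with reg := Function.update (s.toState c).reg x v } := by
  simp only [St.toState, St.set, State.mk.injEq, and_true]
  funext y
  simp [Function.update_apply]

/-- The simulation is step by step with the same `k`, so time bounds proved for `HExec` carry over
with no loss. -/
theorem exec_compile {p : HProg} {k : ℕ} {s' : St} (h : HExec c p s k s') :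
    Exec c.w p.compile (s.toState c) k (s'.toState c) := by
  induction h with
  | skip s => exact .skip _
  | @assign x e s h =>
    rw [toState_set, ← cost_compile, ← eval_compile e h]
    exact .assign _ _ _
  | @store r i e s hr hi hb he =>
    rw [toState_put hr, ← eval_compile e he, ← eval_addr (eval_compile i hi) hb hr]
    have hc : i.cost + e.cost + 10 = (addr r i.compile).cost + e.compile.cost + 1 := by
      simp only [addr, Expr.cost, cost_compile]
      omega
    rw [hc]
    exact .store _ _ _
  | @emit e s h =>
    rw [← cost_compile]
    have := Exec.emit (w := c.w) e.compile (s.toState c)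
    rw [eval_compile e h] at this
    exact this
  | seq _ _ h1 h2 => exact .seq h1 h2
  | ite_true h0 h1 _ h2 =>
    rw [← cost_compile]
    exact .ite_true (by rwa [eval_compile _ h0]) h2
  | ite_false h0 h1 _ h2 =>
    rw [← cost_compile]
    exact .ite_false (by rwa [eval_compile _ h0]) h2
  | loop_true h0 h1 _ _ h2 h3 =>
    rw [← cost_compile]
    exact .loop_true (by rwa [eval_compile _ h0]) h2 h3
  | loop_false h0 h1 =>
    rw [← cost_compile]
    exact .loop_false (by rwa [eval_compile _ h0])

theorem encodeExpr_length {i : ℕ} (e : SLPExpr ℕ i) : (SLP.encodeExpr e).length = 3 := by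
  cases e <;> rfl

theorem encode_length (G : SLP ℕ) : G.encode.length = 3 * G.size + 1 := by
  simp [SLP.encode, List.length_flatMap, encodeExpr_length, Nat.mul_comm]

/-- The initial state. -/
def St.init : St := ⟨fun _ => 0, fun _ _ => 0, []⟩

theorem toState_init : St.init.toState c = initial c.G.encode := by
  simp only [St.toState, St.init, initial, State.mk.injEq, true_and, and_true]
  funext a
  split_ifs with h
  · rfl
  · rw [List.getD_eq_default _ _ (by rw [encode_length]; omega)]

end BisectionRAM

namespace BisectionRAM

/-! ### Straight line programs, indexed by natural numbers -/

theorem flatMap_getElem? {α β : Type*} {f : α → List β} {d : ℕ} (hf : ∀ a, (f a).length = d)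
    (l : List α) (i k : ℕ) (hk : k < d) :
    (l.flatMap f)[d * i + k]? = (l[i]?).bind fun a => (f a)[k]? := by
  induction l generalizing i with
  | nil => simp
  | cons a l ih =>
    rw [List.flatMap_cons]
    cases i with
    | zero => rw [List.getElem?_append_left (by rw [hf]; omega)]; simp
    | succ i =>
      rw [List.getElem?_append_right (by rw [hf, Nat.mul_succ]; omega), hf,
        show d * (i + 1) + k - d = d * i + k by rw [Nat.mul_succ]; omega, ih]
      simp

theorem word_eq {G : SLP ℕ} {i k : ℕ} (hi : i < G.size) (hk : k < 3) :
    word G i k = (SLP.encodeExpr (G.rule ⟨i, hi⟩)).getD k 0 := by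
  rw [word, SLP.encode, ← Nat.add_assoc, List.getD_cons_succ, List.getD_eq_getElem?_getD,
    flatMap_getElem? (fun _ => encodeExpr_length _) _ _ _ hk, List.getD_eq_getElem?_getD]
  simp [hi]

/-- The string derived from the `i`-th variable, empty if there is none. -/
def str (G : SLP ℕ) (i : ℕ) : List ℕ := if h : i < G.size then G.val ⟨i, h⟩ else []

variable {G : SLP ℕ}

theorem str_letter {i : ℕ} (hi : i < G.size) (h : word G i 0 = 0) : str G i = [word G i 1] := by
  rw [word_eq hi (by norm_num)] at h ⊢
  rw [str, dif_pos hi, SLP.val]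
  cases hr : G.rule ⟨i, hi⟩ with
  | letter a => simp [SLP.encodeExpr]
  | pair l r => simp [hr, SLP.encodeExpr] at h

theorem str_pair {i : ℕ} (hi : i < G.size) (h : word G i 0 ≠ 0) :
    word G i 1 < i ∧ word G i 2 < i ∧ str G i = str G (word G i 1) ++ str G (word G i 2) := by
  rw [word_eq hi (by norm_num)] at h ⊢
  rw [word_eq hi (by norm_num)]
  cases hr : G.rule ⟨i, hi⟩ with
  | letter a => simp [hr, SLP.encodeExpr] at h
  | pair l r =>
    have hl := l.isLt
    have hr' := r.isLt
    simp only at hl hr'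
    refine ⟨by simp [SLP.encodeExpr], by simp [SLP.encodeExpr], ?_⟩
    simp only [SLP.encodeExpr, List.getD_cons_zero, List.getD_cons_succ]
    rw [str, dif_pos hi, SLP.val, str, dif_pos (hl.trans hi), str, dif_pos (hr'.trans hi)]
    simp only [hr]
    rfl

theorem str_last : str G (G.size - 1) = G.string := by
  rw [str, dif_pos (Nat.sub_lt G.size_pos Nat.one_pos)]; rfl

theorem str_length_pos {i : ℕ} (hi : i < G.size) : 0 < (str G i).length := by
  induction i using Nat.strong_induction_on with
  | _ i ih =>
    by_cases h : word G i 0 = 0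
    · simp [str_letter hi h]
    · obtain ⟨h1, h2, h3⟩ := str_pair hi h
      have := ih _ h1 (h1.trans hi)
      rw [h3, List.length_append]
      omega

theorem str_length_le {i : ℕ} (hi : i < G.size) : (str G i).length ≤ 2 ^ i := by
  induction i using Nat.strong_induction_on with
  | _ i ih =>
    by_cases h : word G i 0 = 0
    · simp [str_letter hi h, Nat.one_le_two_pow]
    · obtain ⟨h1, h2, h3⟩ := str_pair hi h
      have a1 := ih _ h1 (h1.trans hi)
      have a2 := ih _ h2 (h2.trans hi)
      have b1 := Nat.pow_le_pow_right (n := 2) (by norm_num) (Nat.le_sub_one_of_lt h1)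
      have b2 := Nat.pow_le_pow_right (n := 2) (by norm_num) (Nat.le_sub_one_of_lt h2)
      have : 2 ^ i = 2 * 2 ^ (i - 1) := by
        rw [← pow_succ', Nat.sub_add_cancel (by omega)]
      rw [h3, List.length_append]
      omega

theorem string_length_lt : G.string.length < 2 ^ G.size := by
  have h := G.size_pos
  rw [← str_last]
  refine (str_length_le (Nat.sub_lt h Nat.one_pos)).trans_lt
    (Nat.pow_lt_pow_right (by norm_num) (by omega))

theorem string_length_pos : 0 < G.string.length := by
  rw [← str_last]
  exact str_length_pos (Nat.sub_lt G.size_pos Nat.one_pos)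

/-! ### The strings of the Bisection grammar -/

/-- The number of strings that appear in the Bisection of `S`. -/
noncomputable def partCount (S : List ℕ) : ℕ := {u | BisectionPart S u}.ncard

theorem bisectionSplit_pos (l : ℕ) : 0 < bisectionSplit l := by simp [bisectionSplit]

theorem bisectionSplit_lt {l : ℕ} (h : 2 ≤ l) : bisectionSplit l < l := by
  have := Nat.pow_log_le_self 2 (x := l - 1) (by omega)
  rw [bisectionSplit]; omega

theorem le_two_mul_bisectionSplit {l : ℕ} : l ≤ 2 * bisectionSplit l := by
  have := Nat.lt_pow_succ_log_self (b := 2) (by norm_num) (l - 1)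
  rw [bisectionSplit, ← pow_succ']
  simp only [Nat.succ_eq_add_one] at this
  omega

theorem bisectionSplit_le {l k : ℕ} (h2 : 2 ≤ l) (h : l ≤ 2 ^ (k + 1)) :
    bisectionSplit l ≤ 2 ^ k := by
  rw [bisectionSplit]
  refine Nat.pow_le_pow_right (by norm_num) (Nat.lt_succ_iff.1 ?_)
  exact Nat.log_lt_of_lt_pow (by omega) (by simp only [Nat.succ_eq_add_one]; omega)

theorem part_block {S u : List ℕ} (h : BisectionPart S u) :
    ∃ p, p + u.length ≤ S.length ∧ u = block S p u.length := by
  induction h with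
  | root => exact ⟨0, by simp, by simp [block]⟩
  | @left u _ h2 ih =>
    obtain ⟨p, h1, h3⟩ := ih
    have := bisectionSplit_lt h2
    refine ⟨p, by simp; omega, ?_⟩
    rw [List.length_take, min_eq_left this.le, ← block_take this.le, ← h3]
  | @right u _ h2 ih =>
    obtain ⟨p, h1, h3⟩ := ih
    have := bisectionSplit_lt h2
    refine ⟨p + bisectionSplit u.length, by simp; omega, ?_⟩
    rw [List.length_drop, ← block_drop, ← h3]

theorem part_mem {S u : List ℕ} (h : BisectionPart S u) :
    u ∈ (fun q : ℕ × ℕ => block S q.1 q.2) ''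
      ((Finset.range (S.length + 1) ×ˢ Finset.range (S.length + 1) : Finset (ℕ × ℕ)) :
        Set (ℕ × ℕ)) := by
  obtain ⟨p, h1, h2⟩ := part_block h
  refine ⟨(p, u.length), ?_, h2.symm⟩
  simp; omega

theorem parts_finite (S : List ℕ) : {u | BisectionPart S u}.Finite :=
  ((Finset.finite_toSet _).image _).subset fun _ h => part_mem h

/-- A part is fixed by a position and a length, each with at most `|S| + 1` values. This keeps the
table indices polynomial in the quantities that bound the word size. -/
theorem partCount_le (S : List ℕ) : partCount S ≤ (S.length + 1) ^ 2 := by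
  refine (Set.ncard_le_ncard (fun u h => part_mem h) ((Finset.finite_toSet _).image _)).trans ?_
  refine (Set.ncard_image_le (Finset.finite_toSet _)).trans ?_
  rw [Set.ncard_coe_finset, Finset.card_product, Finset.card_range, sq]

theorem partCount_pos (S : List ℕ) : 0 < partCount S :=
  (Set.ncard_pos (parts_finite S)).2 ⟨S, .root⟩

/-! ### Descending to the input variable whose cut an interval crosses -/

/-- The bound `bd` leaves room for all the numbers that occur. -/
def Ctx.Big (c : Ctx) : Prop :=
  (partCount c.G.string + 1) * c.G.size + 4 * c.G.string.length + 4 * c.G.size +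
    partCount c.G.string + 1000 ≤ c.bd

/-- The length of `str i` is found in the array number `8`, if it is at most that of the whole
string. -/
def LenOK (c : Ctx) (s : St) : Prop :=
  ∀ i < c.G.size, (str c.G i).length ≤ c.G.string.length → s.arr 8 i = (str c.G i).length

/-- The interval `[p, p + l)` of the variable `j` lies on both sides of its cut, unless `j` is a
letter. -/
def Cross (G : SLP ℕ) (j p l : ℕ) : Prop :=
  word G j 0 = 0 ∨ p < (str G (word G j 1)).length ∧ (str G (word G j 1)).length < p + l

/-- The interval of length `l` at `p` in the variable `j` corresponds to the one at `p'` in `j'`,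
which crosses the cut. -/
structure Located (G : SLP ℕ) (j p l j' p' : ℕ) : Prop where
  lt : j' < G.size
  le : p' + l ≤ (str G j').length
  length_le : (str G j').length ≤ G.string.length
  occ : ∀ v : List ℕ, v.length = l → (Occ v (str G j) p ↔ Occ v (str G j') p')
  cross : Cross G j' p' l

/-- The registers below `lo` and the output are unchanged. -/
def Frame (lo : ℕ) (s s' : St) : Prop := (∀ x < lo, s'.reg x = s.reg x) ∧ s'.out = s.out

section Frame

variable {lo hi x v r i : ℕ} {s s' s'' : St}

theorem Frame.refl : Frame lo s s := ⟨fun _ _ => rfl, rfl⟩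

theorem Frame.trans (h : Frame lo s s') (h' : Frame hi s' s'') (hl : lo ≤ hi) : Frame lo s s'' :=
  ⟨fun x hx => (h'.1 x (hx.trans_le hl)).trans (h.1 x hx), h'.2.trans h.2⟩

theorem Frame.set (h : Frame lo s s') (hx : lo ≤ x) : Frame lo s (s'.set x v) :=
  ⟨fun y hy => by rw [St.set_reg, if_neg (by omega), h.1 y hy], h.2⟩

@[simp] theorem frame_refl : Frame lo s s := .refl

@[simp] theorem frame_set (hx : lo ≤ x) : Frame lo s (s'.set x v) ↔ Frame lo s s' := by
  refine and_congr (forall₂_congr fun y hy => ?_) Iff.rfl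
  rw [St.set_reg, if_neg (by omega)]

@[simp] theorem frame_put : Frame lo s (s'.put r i v) ↔ Frame lo s s' := Iff.rfl

end Frame

/-- Registers: `60` the variable, `61` the position, `62` the length. -/
def locate : HProg := .list [
  .assign 63 1,
  .loop (.reg 63) (.ite (.rule 0 (.reg 60))
    (.list [
      .assign 64 (.arr 8 (.rule 1 (.reg 60))),
      .ite (.lt (.reg 61 + .reg 62) (.reg 64 + 1))
        (.assign 60 (.rule 1 (.reg 60)))
        (.ite (.lt (.reg 61) (.reg 64))
          (.assign 63 0)
          (.list [.assign 61 (.reg 61 - .reg 64), .assign 60 (.rule 2 (.reg 60))]))])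
    (.assign 63 0))]

/-- Children have smaller numbers than their variable, so the number of the current variable plus
one serves as loop index. Once the flag `63` is cleared the index is free. -/
structure LocateInv (c : Ctx) (s : St) (j p l i : ℕ) (s' : St) : Prop where
  frame : Frame 60 s s'
  arr : s'.arr = s.arr
  len : s'.reg 62 = l
  lt : s'.reg 60 < c.G.size
  le : s'.reg 61 + l ≤ (str c.G (s'.reg 60)).length
  length_le : (str c.G (s'.reg 60)).length ≤ c.G.string.length
  occ : ∀ v : List ℕ, v.length = l → (Occ v (str c.G j) p ↔ Occ v (str c.G (s'.reg 60)) (s'.reg 61))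
  go : (s'.reg 63 = 1 ∧ i = s'.reg 60 + 1) ∨ (s'.reg 63 = 0 ∧ Cross c.G (s'.reg 60) (s'.reg 61) l)

theorem locate_spec {c : Ctx} (hb : c.Big) {s : St} (hl : LenOK c s) {j p l : ℕ}
    (hj : s.reg 60 = j) (hp : s.reg 61 = p) (hlen : s.reg 62 = l) (hjn : j < c.G.size)
    (hl0 : 0 < l) (hle : p + l ≤ (str c.G j).length)
    (hN : (str c.G j).length ≤ c.G.string.length) :
    Run c locate s fun k s' => k ≤ 110 * c.G.size ∧ Frame 60 s s' ∧ s'.arr = s.arr ∧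
      s'.reg 62 = l ∧ Located c.G j p l (s'.reg 60) (s'.reg 61) := by
  unfold Ctx.Big at hb
  have hn := c.G.size_pos
  simp only [locate, run_cons, run_nil, run_assign]
  refine ⟨by simp; omega, ?_⟩
  refine run_loop (i := j + 1) (LocateInv c s j p l) 90 ?_ ?_ ?_
  · constructor <;> simp [*]
  · intro i s' h
    refine ⟨by simp, fun hne => ?_⟩
    obtain ⟨h63, hi⟩ : s'.reg 63 = 1 ∧ i = s'.reg 60 + 1 := h.go.resolve_right fun h => hne h.1
    have h1 := h.lt
    have h2 := h.le
    have h3 := h.length_le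
    have h4 := h.occ
    by_cases hw : word c.G (s'.reg 60) 0 = 0
    · simp only [run_ite, run_assign, val_rule, val_reg, hw]
      simp [h1]
      exact ⟨0, by omega, h.frame.set (by norm_num), h.arr, h.len, h1, h2, h3, h4,
        .inr ⟨rfl, .inl hw⟩⟩
    obtain ⟨w1, w2, w3⟩ := str_pair h1 hw
    have hlen := congrArg List.length w3
    rw [List.length_append] at hlen
    -- The stored length is exact because the current variable, and hence its left child, is no
    -- longer than `S`.
    have l1 := hl _ (w1.trans h1) (by omega)
    rw [← h.arr] at l1
    rw [w3] at h4
    simp [hw, l1, h.len, h1]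
    refine ⟨by omega, by omega,
      fun hc => ⟨word c.G (s'.reg 60) 1 + 1, by omega, by simpa using h.frame, h.arr, h.len,
        w1.trans h1, hc, by simp; omega, fun v hv => ?_, .inl ⟨h63, rfl⟩⟩,
      fun hc => ⟨fun hc2 => ⟨0, by omega, by simpa using h.frame, h.arr, h.len, h1, h2, h3, h.occ,
        .inr ⟨rfl, .inr ⟨hc2, hc⟩⟩⟩,
      fun hc2 => ⟨word c.G (s'.reg 60) 2 + 1, by omega, by simpa using h.frame, h.arr, h.len,
        w2.trans h1, by simp; omega, by simp; omega, fun v hv => ?_, .inl ⟨h63, rfl⟩⟩⟩⟩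
    · rw [h4 v hv, occ_append_left (by omega)]; rfl
    · rw [h4 v hv, occ_append_right (by omega)]; rfl
  · intro i k s' hi h h0 hk
    simp at h0 hk
    refine ⟨?_, h.frame, h.arr, h.len, h.lt, h.le, h.length_le, h.occ, ?_⟩
    · have := Nat.mul_le_mul_right 90 (show j + 1 ≤ c.G.size from hjn)
      simp; omega
    · rcases h.go with h | h
      · omega
      · exact h.2

end BisectionRAM

namespace BisectionRAM

/-! ### The greatest common divisor -/

/-- Registers: `70` and `71` the arguments, `70` the result. -/
def gcdProg : HProg := .loop (.reg 71)
  (.list [.assign 72 (.mod (.reg 70) (.reg 71)), .assign 70 (.reg 71), .assign 71 (.reg 72)])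

/-- When the arguments are ordered, a round at least halves their product, because `2 * (x % y) ≤ x`
for `0 < y ≤ x`. The second alternative of `size` is the state before the first round, which may
merely swap them. -/
structure GcdInv (n a b : ℕ) (s : St) (i : ℕ) (s' : St) : Prop where
  frame : Frame 70 s s'
  arr : s'.arr = s.arr
  gcd : Nat.gcd (s'.reg 70) (s'.reg 71) = Nat.gcd a b
  size : (s'.reg 71 ≤ s'.reg 70 ∧ s'.reg 70 * s'.reg 71 < 2 ^ i) ∨
    (i = 2 * n + 1 ∧ s'.reg 70 < 2 ^ n ∧ s'.reg 71 < 2 ^ n)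

theorem gcd_spec {c : Ctx} {s : St} {n a b : ℕ} (ha : s.reg 70 = a) (hb : s.reg 71 = b)
    (han : a < 2 ^ n) (hbn : b < 2 ^ n) :
    Run c gcdProg s fun k s' => k ≤ 24 * n + 14 ∧ Frame 70 s s' ∧ s'.arr = s.arr ∧
      s'.reg 70 = Nat.gcd a b := by
  refine run_loop (i := 2 * n + 1) (GcdInv n a b s) 12 ?_ ?_ ?_
  · constructor <;> simp [*]
  · intro i s' h
    refine ⟨by simp, fun hne => ?_⟩
    simp only [val_reg] at hne
    have hpos := Nat.pos_of_ne_zero hne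
    have hlt := Nat.mod_lt (s'.reg 70) hpos
    have hg : Nat.gcd (s'.reg 71) (s'.reg 70 % s'.reg 71) = Nat.gcd a b := by
      rw [← h.gcd, Nat.gcd_comm, ← Nat.gcd_rec, Nat.gcd_comm]
    simp
    rcases h.size with ⟨h1, h2⟩ | ⟨h1, h2, h3⟩
    · have h4 : 2 * (s'.reg 70 % s'.reg 71) ≤ s'.reg 70 := by
        have := Nat.mod_add_div (s'.reg 70) (s'.reg 71)
        have h5 : 0 < s'.reg 70 / s'.reg 71 := Nat.div_pos h1 hpos
        have := Nat.le_mul_of_pos_right (s'.reg 71) h5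
        omega
      have hi : i ≠ 0 := by
        rintro rfl
        have := Nat.mul_pos (hpos.trans_le h1) hpos
        omega
      refine ⟨i - 1, by omega, by simpa using h.frame, h.arr, by simpa using hg,
        .inl ⟨by simpa using hlt.le, ?_⟩⟩
      have h6 : 2 ^ i = 2 * 2 ^ (i - 1) := by rw [← pow_succ', Nat.sub_add_cancel (by omega)]
      have := Nat.mul_le_mul_left (s'.reg 71) h4
      simp
      nlinarith
    · refine ⟨2 * n, by omega, by simpa using h.frame, h.arr, by simpa using hg,
        .inl ⟨by simpa using hlt.le, ?_⟩⟩
      simp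
      rw [two_mul, pow_add]
      exact Nat.mul_lt_mul'' h3 (hlt.trans h3)
  · intro i k s' hi h h0 hk
    simp only [val_reg] at h0
    simp at hk
    refine ⟨by omega, h.frame, h.arr, ?_⟩
    rw [← h.gcd, h0, Nat.gcd_zero_right]

/-! ### The table of facts

The entry number `v * n + j` of the arrays `10` to `13` states that the `v`-th string occurs in the
`j`-th variable at `lo`, `lo + g`, …, `hi`. -/

variable (c : Ctx) (V : ℕ → List ℕ)

/-- The fact that the table records at the index `x`. -/
def EntryFact (a : ℕ → ℕ → ℕ) (x : ℕ) : Prop :=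
  OccProg (V (x / c.G.size)) (str c.G (x % c.G.size)) (a 11 x) (a 12 x) (a 13 x)

/-- These conditions hold whether or not the recorded fact is true, and make the merging and
splitting of progressions valid. That both ends cross the cut bounds the span, through `cross_lt`.
-/
structure EntryOK (a : ℕ → ℕ → ℕ) (x : ℕ) : Prop where
  pos : 0 < (V (x / c.G.size)).length
  dvd : a 13 x ∣ a 12 x - a 11 x
  le : a 11 x + a 13 x ≤ a 12 x
  bound : a 12 x + (V (x / c.G.size)).length ≤ (str c.G (x % c.G.size)).length
  length_le : (str c.G (x % c.G.size)).length ≤ c.G.string.length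
  cross_lo : Cross c.G (x % c.G.size) (a 11 x) (V (x / c.G.size)).length
  cross_hi : Cross c.G (x % c.G.size) (a 12 x) (V (x / c.G.size)).length

def TabOK (a : ℕ → ℕ → ℕ) : Prop := ∀ x, a 10 x ≠ 0 → EntryOK c V a x

def TabFact (a : ℕ → ℕ → ℕ) : Prop := ∀ x, a 10 x ≠ 0 → EntryFact c V a x

variable {c V}

/-- Both intervals straddle the same cut, so one begins before it and the other ends after it. In a
letter there is only one position. -/
theorem cross_lt {G : SLP ℕ} {j p q l : ℕ} (hj : j < G.size) (hp : Cross G j p l)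
    (hq : Cross G j q l) (hl : 0 < l) (hql : q + l ≤ (str G j).length) : q < p + l := by
  rcases hp with hp | hp
  · rw [str_letter hj hp] at hql
    simp at hql; omega
  · rcases hq with hq | hq
    · rw [str_letter hj hq] at hql
      simp at hql; omega
    · omega

theorem EntryFact.congr {a a' : ℕ → ℕ → ℕ} {x : ℕ} (h : ∀ r, a' r x = a r x) :
    EntryFact c V a' x ↔ EntryFact c V a x := by
  simp [EntryFact, h]

theorem EntryOK.congr {a a' : ℕ → ℕ → ℕ} {x : ℕ} (h : ∀ r, a' r x = a r x)
    (ha : EntryOK c V a x) : EntryOK c V a' x := by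
  have h3 := ha.dvd
  have h4 := ha.le
  have h5 := ha.bound
  have h6 := ha.cross_lo
  have h7 := ha.cross_hi
  rw [← h] at h6 h7
  rw [← h, ← h, ← h] at h3 h4
  rw [← h] at h5
  exact ⟨ha.pos, h3, h4, h5, ha.length_le, h6, h7⟩

/-- The table stands for the conjunction of its facts. If only the entry `y` changes and its own
fact gains the conjunct `P`, then so does the whole table. -/
theorem tab_update {a a' : ℕ → ℕ → ℕ} {y : ℕ} {P : Prop} (h : ∀ r x, x ≠ y → a' r x = a r x)
    (hy : a' 10 y ≠ 0) (hok : EntryOK c V a' y)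
    (hf : EntryFact c V a' y ↔ ((a 10 y ≠ 0 → EntryFact c V a y) ∧ P)) (ht : TabOK c V a) :
    TabOK c V a' ∧ (TabFact c V a' ↔ TabFact c V a ∧ P) := by
  refine ⟨fun x hx => ?_, ⟨fun h' => ?_, fun h' x hx => ?_⟩⟩
  · by_cases hxy : x = y
    · exact hxy ▸ hok
    · exact (ht x (by rwa [← h _ _ hxy])).congr (fun r => h r x hxy)
  · have h1 := hf.1 (h' y hy)
    refine ⟨fun x hx => ?_, h1.2⟩
    by_cases hxy : x = y
    · subst hxy; exact h1.1 hx
    · exact (EntryFact.congr (fun r => h r x hxy)).1 (h' x (by rwa [h _ _ hxy]))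
  · by_cases hxy : x = y
    · subst hxy; exact hf.2 ⟨h'.1 x, h'.2⟩
    · exact (EntryFact.congr (fun r => h r x hxy)).2 (h'.1 x (by rwa [← h _ _ hxy]))

theorem gcd_dvd_span {lo hi g p : ℕ} (hd : g ∣ hi - lo) (hle : lo + g ≤ hi) :
    Nat.gcd g (p - lo + (lo - p)) ∣ max hi p - min lo p := by
  have g1 := (Nat.gcd_dvd_left g (p - lo + (lo - p))).trans hd
  have g2 := Nat.gcd_dvd_right g (p - lo + (lo - p))
  rcases lt_or_ge p lo with h | h
  · rw [show max hi p - min lo p = (hi - lo) + (p - lo + (lo - p)) by omega]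
    exact dvd_add g1 g2
  · rcases lt_or_ge hi p with h' | h'
    · rwa [show max hi p - min lo p = p - lo + (lo - p) by omega]
    · rwa [show max hi p - min lo p = hi - lo by omega]

theorem gcd_le_span {lo hi g p : ℕ} (hle : lo + g ≤ hi) :
    min lo p + Nat.gcd g (p - lo + (lo - p)) ≤ max hi p := by
  rcases Nat.eq_zero_or_pos (p - lo + (lo - p)) with h | h
  · rw [h, Nat.gcd_zero_right]; omega
  · have := Nat.gcd_le_right g h
    omega

/-- Records that the string number `50` occurs in the variable `60` at the position `61`. -/
def insert : HProg := .list [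
  .assign 62 (.arr 0 (.reg 50)),
  locate,
  .assign 51 (.reg 50 * .size + .reg 60),
  .ite (.arr 10 (.reg 51))
    (.list [
      .assign 52 (.arr 11 (.reg 51)),
      .assign 53 (.arr 12 (.reg 51)),
      .assign 70 (.arr 13 (.reg 51)),
      .assign 71 ((.reg 61 - .reg 52) + (.reg 52 - .reg 61)),
      gcdProg,
      .store 13 (.reg 51) (.reg 70),
      .store 11 (.reg 51) (.reg 52 - (.reg 52 - .reg 61)),
      .store 12 (.reg 51) (.reg 53 + (.reg 61 - .reg 53))])
    (.list [
      .store 10 (.reg 51) 1,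
      .store 11 (.reg 51) (.reg 61),
      .store 12 (.reg 51) (.reg 61),
      .store 13 (.reg 51) 0])]

theorem index_le (hb : c.Big) {v j : ℕ} (hv : v < partCount c.G.string) (hj : j < c.G.size) :
    v * c.G.size + j ≤ c.bd ∧ v * c.G.size ≤ c.bd := by
  unfold Ctx.Big at hb
  have := Nat.mul_le_mul_right c.G.size (show v + 1 ≤ partCount c.G.string + 1 by omega)
  rw [Nat.succ_mul] at this
  omega

theorem insert_spec (hb : c.Big) {s : St} (hl : LenOK c s) {v j p : ℕ}
    (hv : s.reg 50 = v) (hj : s.reg 60 = j) (hp : s.reg 61 = p) (hvM : v < partCount c.G.string)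
    (hVlen : s.arr 0 v = (V v).length) (hV0 : 0 < (V v).length) (hjn : j < c.G.size)
    (hle : p + (V v).length ≤ (str c.G j).length)
    (hN : (str c.G j).length ≤ c.G.string.length) (ht : TabOK c V s.arr) :
    Run c insert s fun k s' => k ≤ 400 * c.G.size ∧ Frame 51 s s' ∧
      (∀ r x, r < 10 ∨ x / c.G.size ≠ v → s'.arr r x = s.arr r x) ∧
      TabOK c V s'.arr ∧ (TabFact c V s'.arr ↔ TabFact c V s.arr ∧ Occ (V v) (str c.G j) p) := by
  have hn := c.G.size_pos
  have hB := hb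
  unfold Ctx.Big at hb
  simp only [insert, run_cons, run_assign]
  refine ⟨by simp; omega, ?_⟩
  refine (locate_spec hB (s := s.set 62 _) hl (j := j) (p := p) (l := (V v).length) ?_ ?_ ?_ hjn hV0
    hle hN).mono ?_
  · simpa using hj
  · simpa using hp
  · simp [hv, hVlen]
  rintro k1 s1 ⟨hk1, hf1, ha1, h62, hL⟩
  have h50 : s1.reg 50 = v := by rw [hf1.1 _ (by norm_num)]; simpa using hv
  have hF : Frame 51 s s1 := by
    refine ⟨fun x hx => ?_, ?_⟩
    · rw [hf1.1 _ (by omega)]; simp; omega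
    · rw [hf1.2]; rfl
  rw [St.set_arr] at ha1
  generalize hj' : s1.reg 60 = j' at hL
  generalize hp' : s1.reg 61 = p' at hL
  obtain ⟨hidx, hidx'⟩ := index_le hB hvM hL.lt
  have hL2 := hL.le
  have hL3 := hL.length_le
  set y := v * c.G.size + j' with hy
  have hdiv : y / c.G.size = v := by
    rw [hy, Nat.mul_comm, Nat.mul_add_div hn, Nat.div_eq_of_lt hL.lt, Nat.add_zero]
  have hmod : y % c.G.size = j' := by
    rw [hy, Nat.mul_comm, Nat.mul_add_mod, Nat.mod_eq_of_lt hL.lt]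
  have hne : ∀ {r x}, r < 10 ∨ x / c.G.size ≠ v → (r < 10 ∨ x ≠ y) := fun {r x} h =>
    h.imp_right fun h h' => h (h' ▸ hdiv)
  refine ⟨by simp [h50, hj', ← hy, hidx, hidx'], ?_⟩
  simp only [val_add, val_mul, val_reg, val_size, h50, hj', ← hy]
  by_cases hfl : s.arr 10 y = 0
  · simp [ha1, hfl, hp', hidx]
    refine ⟨by omega, by omega, hF, fun r x hrx => ?_, ?_⟩
    · have := hne hrx
      repeat rw [if_neg (by omega)]
    rw [hL.occ _ rfl]
    refine tab_update (y := y) (fun r x hx => by simp [ha1, hx]) (by simp)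
      ⟨by rwa [hdiv], by simp, by simp, ?_, by rwa [hmod], ?_, ?_⟩ ?_ ht
    · simpa [hdiv, hmod] using hL.le
    · simpa [hdiv, hmod] using hL.cross
    · simpa [hdiv, hmod] using hL.cross
    · simp [hfl, EntryFact, hdiv, hmod, occProg_single]
  · have hok := ht y hfl
    obtain ⟨-, o2, o3, o4, o5, o6, o7⟩ := hok
    rw [hdiv, hmod] at o4 o6 o7
    have w1 := cross_lt hL.lt o6 hL.cross hV0 hL2
    have w2 := cross_lt hL.lt hL.cross o7 hV0 o4
    have w3 := cross_lt hL.lt o6 o7 hV0 o4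
    -- Positions and steps stay below `2 ^ n`, so Euclid's algorithm needs only `O(n)` rounds.
    have hlt := string_length_lt (G := c.G)
    simp [ha1, hfl, hp', hidx]
    refine ⟨by omega, ?_⟩
    refine (gcd_spec (n := c.G.size) (a := s.arr 13 y)
      (b := p' - s.arr 11 y + (s.arr 11 y - p')) (by simp) (by simp) (by omega) (by omega)).mono ?_
    rintro k2 s2 ⟨hk2, hf2, ha2, h70⟩
    have r51 : s2.reg 51 = y := by rw [hf2.1 _ (by norm_num)]; simp
    have r52 : s2.reg 52 = s.arr 11 y := by rw [hf2.1 _ (by norm_num)]; simp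
    have r53 : s2.reg 53 = s.arr 12 y := by rw [hf2.1 _ (by norm_num)]; simp
    have r61 : s2.reg 61 = p' := by rw [hf2.1 _ (by norm_num)]; simpa using hp'
    simp at ha2
    -- Truncated subtraction replaces case distinctions: it gives the minimum, the maximum and the
    -- distance of two positions.
    have hmin : s.arr 11 y - (s.arr 11 y - p') = min (s.arr 11 y) p' := by omega
    have hmax : s.arr 12 y + (p' - s.arr 12 y) = max (s.arr 12 y) p' := by omega
    simp [r51, r52, r53, r61, h70, hidx, ha2, ha1, hmin, hmax]
    refine ⟨by omega, by omega, ?_, fun r x hrx => ?_, ?_⟩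
    · exact Frame.trans (by simpa using hF) hf2 (by norm_num)
    · have := hne hrx
      repeat rw [if_neg (by omega)]
    rw [hL.occ _ rfl]
    have g1 := Nat.gcd_dvd_left (s.arr 13 y) (p' - s.arr 11 y + (s.arr 11 y - p'))
    have g2 := Nat.gcd_dvd_right (s.arr 13 y) (p' - s.arr 11 y + (s.arr 11 y - p'))
    refine tab_update (y := y) (fun r x hx => by simp [ha1, ha2, hx]) (by simpa [ha2, ha1] using hfl)
      ⟨by rwa [hdiv], ?_, ?_, ?_, by rwa [hmod], ?_, ?_⟩ ?_ ht
    · simpa using gcd_dvd_span o2 o3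
    · simpa using gcd_le_span o3
    · simp [hdiv, hmod]
      omega
    · simp [hdiv, hmod]
      rcases le_total (s.arr 11 y) p' with h | h
      · rwa [min_eq_left h]
      · rw [min_eq_right h]; exact hL.cross
    · simp [hdiv, hmod]
      rcases le_total (s.arr 12 y) p' with h | h
      · rw [max_eq_right h]; exact hL.cross
      · rwa [max_eq_left h]
    · simp [hfl, EntryFact, hdiv, hmod]
      exact (occProg_insert o2 o3 w3 w1 w2).symm

end BisectionRAM

namespace BisectionRAM

/-! ### Testing an occurrence -/

variable {c : Ctx} {V : ℕ → List ℕ}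

/-- The arrays `0` to `2` hold a grammar with `m` variables, which derive the strings `V t`. -/
structure Gram (S : List ℕ) (m : ℕ) (V : ℕ → List ℕ) (a : ℕ → ℕ → ℕ) : Prop where
  len : ∀ t < m, a 0 t = (V t).length
  pos : ∀ t < m, 0 < (V t).length
  letter : ∀ t < m, (V t).length = 1 → V t = [a 1 t] ∧ a 2 t = 0
  pair : ∀ t < m, (V t).length ≠ 1 → a 1 t < t ∧ a 2 t < t ∧ V t = V (a 1 t) ++ V (a 2 t) ∧
    (V (a 1 t)).length = bisectionSplit (V t).length
  part : ∀ t < m, BisectionPart S (V t)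
  inj : ∀ t < m, ∀ t' < m, V t = V t' → t = t'

theorem Gram.congr {S : List ℕ} {m : ℕ} {a a' : ℕ → ℕ → ℕ} (h : Gram S m V a)
    (ha : ∀ r x, r < 10 → a' r x = a r x) : Gram S m V a' := by
  have h0 : a' 0 = a 0 := funext fun x => ha 0 x (by norm_num)
  have h1 : a' 1 = a 1 := funext fun x => ha 1 x (by norm_num)
  have h2 : a' 2 = a 2 := funext fun x => ha 2 x (by norm_num)
  constructor
  · rw [h0]; exact h.len
  · exact h.pos
  · rw [h1, h2]; exact h.letter
  · rw [h1, h2]; exact h.pair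
  · exact h.part
  · exact h.inj

theorem Gram.le_partCount {S : List ℕ} {m : ℕ} {a : ℕ → ℕ → ℕ} (h : Gram S m V a) :
    m ≤ partCount S := by
  have h1 : (Finset.image V (Finset.range m)).card = m := by
    rw [Finset.card_image_of_injOn, Finset.card_range]
    intro t ht t' ht' heq
    exact h.inj t (by simpa using ht) t' (by simpa using ht') heq
  rw [← h1, ← Set.ncard_coe_finset]
  refine Set.ncard_le_ncard (fun u hu => ?_) (parts_finite S)
  simp only [Finset.coe_image, Set.mem_image] at hu
  obtain ⟨t, ht, rfl⟩ := hu
  exact h.part t (by simpa using ht)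

theorem LenOK.congr {s s' : St} (h : LenOK c s) (ha : ∀ r x, r < 10 → s'.arr r x = s.arr r x) :
    LenOK c s' := fun i hi hle => by rw [ha _ _ (by norm_num)]; exact h i hi hle

/-- Splits the fact that the string number `44` occurs in the variable `45` at the position in the
register `r`. -/
def splitFact (r : ℕ) : HProg := .list [
  .assign 50 (.arr 1 (.reg 44)), .assign 60 (.reg 45), .assign 61 (.reg r), insert,
  .assign 50 (.arr 2 (.reg 44)), .assign 60 (.reg 45),
  .assign 61 (.reg r + .arr 0 (.arr 1 (.reg 44))), insert]

/-- Both children of `v` have smaller numbers than `v`, so the new facts are recorded strictly below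
the entries of `v`. This is what allows the table to be cleared from the top down. -/
theorem splitFact_spec (hb : c.Big) {m : ℕ} {s : St} (hl : LenOK c s)
    (hg : Gram c.G.string m V s.arr) {r v j p : ℕ} (hr : r < 50)
    (hv : s.reg 44 = v) (hj : s.reg 45 = j) (hp : s.reg r = p) (hvm : v < m)
    (hV1 : (V v).length ≠ 1) (hjn : j < c.G.size)
    (hle : p + (V v).length ≤ (str c.G j).length)
    (hN : (str c.G j).length ≤ c.G.string.length) (ht : TabOK c V s.arr) :
    Run c (splitFact r) s fun k s' => k ≤ 900 * c.G.size ∧ Frame 50 s s' ∧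
      (∀ r x, r < 10 ∨ v ≤ x / c.G.size → s'.arr r x = s.arr r x) ∧
      TabOK c V s'.arr ∧ (TabFact c V s'.arr ↔ TabFact c V s.arr ∧ Occ (V v) (str c.G j) p) := by
  have hB := hb
  unfold Ctx.Big at hb
  have hn := c.G.size_pos
  have hmM := hg.le_partCount
  obtain ⟨hy, hz, hyz, -⟩ := hg.pair v hvm hV1
  have hlen := congrArg List.length hyz
  rw [List.length_append] at hlen
  have hly := hg.len _ (hy.trans hvm)
  have n50 : r ≠ 50 := by omega
  have n60 : r ≠ 60 := by omega
  have n61 : r ≠ 61 := by omega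
  simp [splitFact, hv, hj, n50, n60, hp]
  refine ⟨by omega, ?_⟩
  refine (insert_spec (V := V) hB (v := s.arr 1 v) (j := j) (p := p) ?_ (by simp) (by simp) (by simp)
    (by omega) (by simpa using hly) (hg.pos _ (hy.trans hvm)) hjn (by omega) hN ?_).mono ?_
  · exact hl
  · exact ht
  rintro k1 s1 ⟨hk1, hf1, ha1, ht1, hF1⟩
  simp at ha1 hF1
  have e44 : s1.reg 44 = v := by rw [hf1.1 _ (by norm_num)]; simpa using hv
  have e45 : s1.reg 45 = j := by rw [hf1.1 _ (by norm_num)]; simpa using hj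
  have er : s1.reg r = p := by
    rw [hf1.1 _ (by omega)]
    simp [n60, n61, n50, hp]
  have hs1 : ∀ r x, r < 10 → s1.arr r x = s.arr r x := fun r x h => ha1 r x (.inl h)
  have b1 := hs1 1 v (by norm_num)
  have b2 := hs1 2 v (by norm_num)
  have b0 := hs1 0 (s.arr 1 v) (by norm_num)
  have hstr := string_length_pos (G := c.G)
  simp [e44, e45, er, b1, b2, b0, hly]
  refine ⟨by omega, by omega, ?_⟩
  refine (insert_spec (V := V) hB (v := s.arr 2 v) (j := j) (p := p + (V (s.arr 1 v)).length) ?_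
    (by simp) (by simp) (by simp)
    (by omega) ?_ (hg.pos _ (hz.trans hvm)) hjn (by omega) hN ?_).mono ?_
  · exact hl.congr hs1
  · simp [hs1]; exact hg.len _ (hz.trans hvm)
  · exact ht1
  rintro k2 s2 ⟨hk2, hf2, ha2, ht2, hF2⟩
  simp at ha2 hF2
  refine ⟨by omega, ⟨fun x hx => ?_, ?_⟩, fun r x h => ?_, ht2, ?_⟩
  · rw [hf2.1 _ (by omega)]
    simp [(hx.trans (by norm_num : 50 < 60)).ne, (hx.trans (by norm_num : 50 < 61)).ne, hx.ne]
    rw [hf1.1 _ (by omega)]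
    simp [(hx.trans (by norm_num : 50 < 60)).ne, (hx.trans (by norm_num : 50 < 61)).ne, hx.ne]
  · rw [hf2.2]; exact hf1.2
  · rw [ha2 _ _ (by omega), ha1 _ _ (by omega)]
  · rw [hF2, hF1, and_assoc]
    conv_rhs => rw [hyz, occ_append]

/-- Checks or splits the facts of the entry number `42`, and clears it. -/
def process : HProg := .ite (.arr 10 (.reg 42))
  (.list [
    .store 10 (.reg 42) 0,
    .ite (.eq (.arr 0 (.reg 44)) 1)
      (.ite (.eq (.arr 1 (.reg 44)) (.rule 1 (.reg 45))) .skip (.assign 43 0))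
      (.list [
        .assign 46 (.arr 11 (.reg 42)),
        .assign 48 (.arr 12 (.reg 42)),
        .assign 47 (.reg 46 + .arr 13 (.reg 42)),
        splitFact 46, splitFact 47, splitFact 48])])
  .skip

theorem tab_clear {a a' : ℕ → ℕ → ℕ} {y : ℕ} (h : ∀ r x, r = 10 ∧ x = y ∨ a' r x = a r x)
    (hy : a 10 y ≠ 0) (hy' : a' 10 y = 0) (ht : TabOK c V a) :
    TabOK c V a' ∧ (TabFact c V a ↔ TabFact c V a' ∧ EntryFact c V a y) := by
  have h' : ∀ x, x ≠ y → ∀ r, a' r x = a r x := fun x hx r => (h r x).resolve_left fun h => hx h.2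
  refine ⟨fun x hx => ?_, ⟨fun hf => ⟨fun x hx => ?_, hf y hy⟩, fun hf x hx => ?_⟩⟩
  · have hxy : x ≠ y := by rintro rfl; exact hx hy'
    exact (ht x (by rwa [← h' x hxy])).congr (h' x hxy)
  · have hxy : x ≠ y := by rintro rfl; exact hx hy'
    exact (EntryFact.congr (h' x hxy)).2 (hf x (by rwa [← h' x hxy]))
  · by_cases hxy : x = y
    · exact hxy ▸ hf.2
    · exact (EntryFact.congr (h' x hxy)).1 (hf.1 x (by rwa [h' x hxy]))

/-- An entry is traded for equivalent facts about shorter strings, or for a comparison of two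
letters whose failure clears the flag `43`. The flag together with the remaining facts keeps its
truth value. -/
theorem process_spec (hb : c.Big) {m : ℕ} {s : St} (hl : LenOK c s)
    (hg : Gram c.G.string m V s.arr) {y : ℕ} (hy : s.reg 42 = y)
    (hv : s.reg 44 = y / c.G.size) (hj : s.reg 45 = y % c.G.size)
    (hym : y < m * c.G.size) (ht : TabOK c V s.arr) :
    Run c process s fun k s' => k ≤ 3000 * c.G.size ∧ Frame 43 s s' ∧
      (∀ r x, r < 10 → s'.arr r x = s.arr r x) ∧
      (∀ x > y, s'.arr 10 x = s.arr 10 x) ∧ s'.arr 10 y = 0 ∧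
      TabOK c V s'.arr ∧
      ((s'.reg 43 ≠ 0 ∧ TabFact c V s'.arr) ↔ (s.reg 43 ≠ 0 ∧ TabFact c V s.arr)) := by
  have hB := hb
  unfold Ctx.Big at hb
  have hn := c.G.size_pos
  have hmM := hg.le_partCount
  have hvm : y / c.G.size < m := Nat.div_lt_of_lt_mul (by rwa [Nat.mul_comm])
  have hjn : y % c.G.size < c.G.size := Nat.mod_lt _ hn
  have hyb : y ≤ c.bd := by
    have := Nat.mul_le_mul_right c.G.size (show m ≤ partCount c.G.string + 1 by omega)
    omega
  by_cases hfl : s.arr 10 y = 0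
  · simp [process, hy, hfl, hyb, ht]
    omega
  have hok := ht y hfl
  obtain ⟨o1, o2, o3, o4, o5, o6, o7⟩ := hok
  have w3 := cross_lt hjn o6 o7 o1 o4
  have hlenv := hg.len _ hvm
  obtain ⟨htc, hfc⟩ := tab_clear (a' := (s.put 10 y 0).arr) (y := y)
    (fun r x => by by_cases h : r = 10 ∧ x = y <;> simp [h]) hfl (by simp) ht
  by_cases h1 : (V (y / c.G.size)).length = 1
  · obtain ⟨hV, -⟩ := hg.letter _ hvm h1
    -- An interval of length one cannot straddle a cut, so the input variable is a letter.
    have hw : word c.G (y % c.G.size) 0 = 0 := by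
      rcases o6 with h | h
      · exact h
      · omega
    have hstr := str_letter hjn hw
    have hhi : s.arr 12 y = 0 := by rw [hstr] at o4; simp at o4; omega
    have hlo : s.arr 11 y = 0 := by omega
    have hgg : s.arr 13 y = 0 := by omega
    have hE : EntryFact c V s.arr y ↔ s.arr 1 (y / c.G.size) = word c.G (y % c.G.size) 1 := by
      rw [EntryFact, hhi, hlo, hgg, occProg_single, hV, hstr, occ_singleton]
      simp [eq_comm]
    rw [hE] at hfc
    by_cases hc : s.arr 1 (y / c.G.size) = word c.G (y % c.G.size) 1
    · simp [process, hy, hv, hj, hfl, hlenv, h1, hjn, hc, htc]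
      refine ⟨by omega, by omega, by omega, by omega, fun r x h h' => by omega, fun x h h' => by omega, ?_⟩
      simp [hfc, hc]
    · simp [process, hy, hv, hj, hfl, hlenv, h1, hjn, hc, htc]
      refine ⟨by omega, by omega, by omega, by omega, fun r x h h' => by omega, fun x h h' => by omega, ?_⟩
      simp [hfc, hc]
  · simp [process, hy, hv, hj, hfl, hlenv, h1, hjn, hyb]
    have hz : 0 ≤ c.bd := by omega
    refine ⟨by omega, by omega, ?_⟩
    -- The whole progression is replaced by three occurrences, which costs six insertions however
    -- many terms it has.
    have hF : EntryFact c V s.arr y ↔ _ := occProg_iff_three o2 o3 w3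
    refine (splitFact_spec hB (m := m) (V := V) (v := y / c.G.size) (j := y % c.G.size)
      (r := 46) (p := s.arr 11 y) ?_ ?_ (by norm_num) (by simpa using hv) (by simpa using hj)
      (by simp) hvm h1 hjn (by omega) o5 ?_).mono ?_
    · exact hl.congr fun r x hr => by simp; omega
    · exact hg.congr fun r x hr => by simp; omega
    · exact htc
    rintro k1 s1 ⟨hk1, hf1, ha1, ht1, hF1⟩
    have hs1 : ∀ r x, r < 10 → s1.arr r x = s.arr r x := fun r x h => by
      rw [ha1 r x (.inl h)]; simp; omega
    refine (splitFact_spec hB (m := m) (V := V) (v := y / c.G.size) (j := y % c.G.size)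
      (r := 47) (p := s.arr 11 y + s.arr 13 y) (hl.congr hs1) (hg.congr hs1) (by norm_num)
      (by rw [hf1.1 _ (by norm_num)]; simpa using hv)
      (by rw [hf1.1 _ (by norm_num)]; simpa using hj)
      (by rw [hf1.1 _ (by norm_num)]; simp) hvm h1 hjn (by omega) o5 ht1).mono ?_
    rintro k2 s2 ⟨hk2, hf2, ha2, ht2, hF2⟩
    have hf12 := hf1.trans hf2 le_rfl
    have hs2 : ∀ r x, r < 10 → s2.arr r x = s.arr r x := fun r x h => by
      rw [ha2 r x (.inl h), hs1 r x h]
    refine (splitFact_spec hB (m := m) (V := V) (v := y / c.G.size) (j := y % c.G.size)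
      (r := 48) (p := s.arr 12 y) (hl.congr hs2) (hg.congr hs2) (by norm_num)
      (by rw [hf12.1 _ (by norm_num)]; simpa using hv)
      (by rw [hf12.1 _ (by norm_num)]; simpa using hj)
      (by rw [hf12.1 _ (by norm_num)]; simp) hvm h1 hjn (by omega) o5 ht2).mono ?_
    rintro k3 s3 ⟨hk3, hf3, ha3, ht3, hF3⟩
    have hf13 := hf12.trans hf3 le_rfl
    have hs3 : ∀ r x, r < 10 → s3.arr r x = s.arr r x := fun r x h => by
      rw [ha3 r x (.inl h), hs2 r x h]
    have hge : ∀ r x, y ≤ x → s3.arr r x = (s.put 10 y 0).arr r x := fun r x h => by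
      have := Nat.div_le_div_right (c := c.G.size) h
      rw [ha3 r x (.inr this), ha2 r x (.inr this), ha1 r x (.inr this)]
      rfl
    refine ⟨by omega, ⟨fun x hx => ?_, hf13.2⟩, hs3, fun x hx => ?_, ?_, ht3, ?_⟩
    · rw [hf13.1 _ (by omega)]
      simp
      repeat rw [if_neg (by omega)]
    · rw [hge _ _ hx.le]
      simp; omega
    · rw [hge _ _ le_rfl]; simp
    · have h43 : s3.reg 43 = s.reg 43 := by rw [hf13.1 _ (by norm_num)]; simp
      have hF1' : TabFact c V s1.arr ↔ TabFact c V (s.put 10 y 0).arr ∧ _ := hF1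
      rw [h43, hF3, hF2, hF1', hfc, hF, and_assoc, and_assoc]

/-- Tests whether the string number `40` occurs at the position `41`, with the result in `43`. -/
def test : HProg := .list [
  .assign 43 1,
  .assign 50 (.reg 40), .assign 60 (.size - 1), .assign 61 (.reg 41), insert,
  .assign 42 ((.reg 40 + 1) * .size),
  .loop (.reg 42) (.list [
    .assign 42 (.reg 42 - 1),
    .assign 44 (.div (.reg 42) .size),
    .assign 45 (.mod (.reg 42) .size),
    process])]

/-- The queried occurrence is equivalent to the flag together with all remaining facts. Entries from
`i` on are clear, so at `i = 0` no fact is left and the flag alone answers the query; the empty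
table is also ready for the next test. -/
structure TestInv (c : Ctx) (V : ℕ → List ℕ) (s : St) (u p i : ℕ) (s' : St) : Prop where
  frame : Frame 42 s s'
  arr : ∀ r x, r < 10 → s'.arr r x = s.arr r x
  tab : TabOK c V s'.arr
  clear : ∀ x ≥ i, s'.arr 10 x = 0
  index : s'.reg 42 = i
  le : i ≤ (u + 1) * c.G.size
  iff : (s'.reg 43 ≠ 0 ∧ TabFact c V s'.arr) ↔ Occ (V u) c.G.string p

theorem test_spec (hb : c.Big) {m : ℕ} {s : St} (hl : LenOK c s)
    (hg : Gram c.G.string m V s.arr) {u p : ℕ} (hu : s.reg 40 = u) (hp : s.reg 41 = p)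
    (hum : u < m) (hle : p + (V u).length ≤ c.G.string.length) (h0 : ∀ x, s.arr 10 x = 0) :
    Run c test s fun k s' => k ≤ 4000 * (m * c.G.size ^ 2) ∧ Frame 42 s s' ∧
      (∀ r x, r < 10 → s'.arr r x = s.arr r x) ∧ (∀ x, s'.arr 10 x = 0) ∧
      (s'.reg 43 ≠ 0 ↔ Occ (V u) c.G.string p) := by
  have hB := hb
  unfold Ctx.Big at hb
  have hn := c.G.size_pos
  have hmM := hg.le_partCount
  have hlast : (str c.G (c.G.size - 1)).length = c.G.string.length := by rw [str_last]
  simp [test, hu, hp]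
  refine ⟨by omega, ?_⟩
  refine (insert_spec (V := V) hB (v := u) (j := c.G.size - 1) (p := p) ?_
    (by simp) (by simp) (by simp) (by omega) ?_ (hg.pos _ hum) (by omega)
    (by rw [hlast]; exact hle) hlast.le ?_).mono ?_
  · exact hl
  · exact hg.len _ hum
  · exact fun x hx => absurd (h0 x) hx
  rintro k1 s1 ⟨hk1, hf1, ha1, ht1, hF1⟩
  simp at ha1 hF1
  have r40 : s1.reg 40 = u := by rw [hf1.1 _ (by norm_num)]; simpa using hu
  have r43 : s1.reg 43 = 1 := by rw [hf1.1 _ (by norm_num)]; simp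
  have hmul := Nat.mul_le_mul_right c.G.size (show u + 1 ≤ m from hum)
  have hmul' := Nat.mul_le_mul_right c.G.size (show m ≤ partCount c.G.string + 1 by omega)
  have hf0 : TabFact c V s.arr := fun x hx => absurd (h0 x) hx
  rw [str_last] at hF1
  simp [r40]
  refine ⟨by omega, ?_⟩
  refine run_loop (i := (u + 1) * c.G.size) (TestInv c V s u p) (3100 * c.G.size) ?_ ?_ ?_
  · refine ⟨⟨fun x hx => ?_, ?_⟩, fun r x h => ?_, ht1, fun x hx => ?_, by simp, le_rfl, ?_⟩
    · rw [St.set_reg, if_neg (by omega), hf1.1 _ (by omega)]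
      simp
      repeat rw [if_neg (by omega)]
    · exact hf1.2
    · exact ha1 r x (.inl h)
    · rw [St.set_arr, ha1 _ _ (.inr ?_), h0]
      intro h
      have := (Nat.div_lt_iff_lt_mul hn).1 (show x / c.G.size < u + 1 by omega)
      omega
    · simp [r43, hF1, hf0]
  · intro i s' h
    refine ⟨by simp, fun hne => ?_⟩
    simp [h.index] at hne
    have := h.le
    simp [h.index]
    refine ⟨by omega, ?_⟩
    refine Run.mono (process_spec (V := V) (m := m) hB (y := i - 1) ?_ ?_ ?_ ?_ ?_
      (by omega) ?_) ?_
    · exact hl.congr h.arr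
    · exact hg.congr h.arr
    iterate 3 simp
    · exact h.tab
    rintro k2 s2 ⟨hk2, hf2, ha2, hc2, hz2, ht2, hF2⟩
    refine ⟨by omega, i - 1, by omega, ⟨fun x hx => ?_, ?_⟩, fun r x hr => ?_, ht2, fun x hx => ?_,
      ?_, by omega, ?_⟩
    · rw [hf2.1 _ (by omega), ← h.frame.1 x hx]
      simp
      repeat rw [if_neg (by omega)]
    · rw [hf2.2]; exact h.frame.2
    · rw [ha2 r x hr]; exact h.arr r x hr
    · rcases Nat.eq_or_lt_of_le hx with hx | hx
      · rw [← hx, hz2]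
      · rw [hc2 x hx]; exact h.clear x (by omega)
    · rw [hf2.1 _ (by norm_num)]; simp
    · rw [hF2, ← h.iff]
      simp
  · intro i k s' hi h h0' hk
    simp only [val_reg, h.index] at h0'
    subst h0'
    have hT : TabFact c V s'.arr := fun x hx => absurd (h.clear x (Nat.zero_le _)) hx
    refine ⟨?_, h.frame, h.arr, fun x => h.clear x (Nat.zero_le _), ?_⟩
    · simp at hk
      have e1 := Nat.mul_le_mul_right (3100 * c.G.size) hmul
      have e2 : m * c.G.size * (3100 * c.G.size) = 3100 * (m * c.G.size ^ 2) := by ring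
      have e3 : c.G.size ≤ m * c.G.size ^ 2 := by
        have : 1 ≤ m := by omega
        nlinarith
      omega
    · rw [← h.iff]
      simp [hT]

end BisectionRAM

namespace BisectionRAM

/-! ### Letters of the string -/

variable {c : Ctx} {V : ℕ → List ℕ}

/-- The letter at the position `61`, in the register `65`. -/
def charAt : HProg := .list [.assign 60 (.size - 1), .assign 62 1, locate,
  .assign 65 (.rule 1 (.reg 60))]

theorem charAt_spec (hb : c.Big) {s : St} (hl : LenOK c s) {p : ℕ} (hp : s.reg 61 = p)
    (hpN : p < c.G.string.length) :
    Run c charAt s fun k s' => k ≤ 150 * c.G.size ∧ Frame 60 s s' ∧ s'.arr = s.arr ∧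
      c.G.string[p]? = some (s'.reg 65) := by
  have hB := hb
  unfold Ctx.Big at hb
  have hn := c.G.size_pos
  have hlast : (str c.G (c.G.size - 1)).length = c.G.string.length := by rw [str_last]
  simp [charAt]
  refine ⟨by omega, ?_⟩
  refine (locate_spec hB (j := c.G.size - 1) (p := p) (l := 1) ?_ ?_ ?_ ?_ (by omega) one_pos
    (by omega) hlast.le).mono ?_
  · exact hl
  · simp
  · simpa using hp
  · simp
  rintro k1 s1 ⟨hk1, hf1, ha1, h62, hL⟩
  have hw : word c.G (s1.reg 60) 0 = 0 := by
    rcases hL.cross with h | h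
    · exact h
    · omega
  have hstr := str_letter hL.lt hw
  have hle := hL.le
  simp [hstr] at hle
  have hocc := hL.occ [word c.G (s1.reg 60) 1] rfl
  rw [hstr, hle, str_last, occ_singleton, occ_singleton] at hocc
  simp at hocc
  simp [hL.lt, hocc, ha1]
  exact ⟨by omega, hf1.1 |> fun h => ⟨fun x hx => by
    rw [h x hx]; simp; repeat rw [if_neg (by omega)], hf1.2⟩⟩

/-! ### The search tree

Each grammar variable `t` has a parent `a 3 t - 1` (none if `a 3 t = 0`) of the same length, from
which it differs at the position `a 4 t`, where it has the letter `a 5 t`. -/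

/-- The only candidate, plus one, among the first `t` variables for the string `b`. -/
def scan (a : ℕ → ℕ → ℕ) (b : List ℕ) : ℕ → ℕ
  | 0 => 0
  | t + 1 => if a 0 t = b.length ∧ a 3 t = scan a b t ∧
      (scan a b t = 0 ∨ b[a 4 t]? = some (a 5 t)) then t + 1 else scan a b t

/-- The parent of `t` is the candidate that a search for `V t` among the earlier variables returns,
and one recorded letter tells `V t` from that parent. -/
structure Trie (m : ℕ) (V : ℕ → List ℕ) (a : ℕ → ℕ → ℕ) : Prop where
  scan_eq : ∀ t < m, a 3 t = scan a (V t) t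
  lt : ∀ t < m, a 3 t ≠ 0 → a 4 t < (V t).length
  sep : ∀ t < m, a 3 t ≠ 0 → (V (a 3 t - 1))[a 4 t]? ≠ some (a 5 t)
  get : ∀ t < m, a 3 t ≠ 0 → (V t)[a 4 t]? = some (a 5 t)

theorem scan_congr {a a' : ℕ → ℕ → ℕ} {m : ℕ} (h : ∀ r x, r < 6 → x < m → a' r x = a r x)
    (b : List ℕ) {t : ℕ} (ht : t ≤ m) : scan a' b t = scan a b t := by
  induction t with
  | zero => rfl
  | succ t ih =>
    rw [scan, scan, ih (by omega), h _ _ (by norm_num) ht, h _ _ (by norm_num) ht,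
      h _ _ (by norm_num) ht, h _ _ (by norm_num) ht]

theorem Trie.congr {a a' : ℕ → ℕ → ℕ} {m : ℕ} (h : Trie m V a)
    (ha : ∀ r x, r < 6 → x < m → a' r x = a r x) : Trie m V a' := by
  constructor <;> intro t ht
  · rw [ha _ _ (by norm_num) ht, scan_congr ha _ ht.le]; exact h.scan_eq t ht
  all_goals repeat rw [ha _ _ (by norm_num) ht]
  · exact h.lt t ht
  · exact h.sep t ht
  · exact h.get t ht

theorem scan_le (a : ℕ → ℕ → ℕ) (b : List ℕ) (t : ℕ) : scan a b t ≤ t := by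
  induction t with
  | zero => exact le_rfl
  | succ t ih => rw [scan]; split_ifs <;> omega

theorem scan_length {a : ℕ → ℕ → ℕ} {b : List ℕ} {t : ℕ} (h : scan a b t ≠ 0) :
    a 0 (scan a b t - 1) = b.length := by
  induction t with
  | zero => exact absurd rfl h
  | succ t ih =>
    rw [scan] at h ⊢
    split_ifs with h1
    · simpa using h1.1
    · rw [if_neg h1] at h; exact ih h

/-- Up to `i`, the scan repeats the search that determined the parent of `i`, and therefore steps to
`i`. It never leaves `i` again, because a child of `i` is entered only at a letter where it differs
from `V i`. -/
theorem scan_found {S : List ℕ} {m : ℕ} {a : ℕ → ℕ → ℕ} (hg : Gram S m V a) (ht : Trie m V a)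
    {i : ℕ} (him : i < m) {t : ℕ} (hit : i < t) (htm : t ≤ m) : scan a (V i) t = i + 1 := by
  induction t with
  | zero => omega
  | succ t ih =>
    rw [scan]
    rcases Nat.eq_or_lt_of_le (Nat.lt_succ_iff.1 hit) with h | h
    · subst h
      refine if_pos ⟨hg.len i him, ht.scan_eq i him, ?_⟩
      by_cases h0 : a 3 i = 0
      · left; rw [← ht.scan_eq i him, h0]
      · right; exact ht.get i him h0
    · rw [ih h (by omega), if_neg]
      rintro ⟨-, h2, h3⟩
      have := ht.sep t htm (by omega)
      rw [h2] at this
      rcases h3 with h3 | h3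
      · omega
      · exact this h3

/-- What holds between the operations of the main loop: there are `m` grammar variables. -/
structure Inv (c : Ctx) (m : ℕ) (V : ℕ → List ℕ) (s : St) : Prop where
  len : LenOK c s
  gram : Gram c.G.string m V s.arr
  trie : Trie m V s.arr
  clear : ∀ x, s.arr 10 x = 0
  count : s.reg 10 = m

theorem Inv.congr {m : ℕ} {s s' : St} (h : Inv c m V s)
    (ha : ∀ r x, r < 10 → s'.arr r x = s.arr r x) (h0 : ∀ x, s'.arr 10 x = 0)
    (hr : s'.reg 10 = s.reg 10) : Inv c m V s' :=
  ⟨h.len.congr ha, h.gram.congr ha, h.trie.congr fun r x hr _ => ha r x (by omega), h0, hr.trans h.count⟩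

/-- Finds the candidate, plus one, for the block at the position `20` of the length `21`. -/
def scanProg : HProg := .list [
  .assign 23 0, .assign 26 0,
  .loop (.lt (.reg 26) (.reg 10)) (.list [
    .ite (.eq (.arr 0 (.reg 26)) (.reg 21))
      (.ite (.eq (.arr 3 (.reg 26)) (.reg 23))
        (.ite (.eq (.reg 23) 0)
          (.assign 23 (.reg 26 + 1))
          (.list [.assign 61 (.reg 20 + .arr 4 (.reg 26)), charAt,
            .ite (.eq (.reg 65) (.arr 5 (.reg 26))) (.assign 23 (.reg 26 + 1)) .skip]))
        .skip)
      .skip,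
    .assign 26 (.reg 26 + 1)])]

structure ScanInv (m : ℕ) (b : List ℕ) (s : St) (i : ℕ) (s' : St) : Prop where
  frame : Frame 22 s s'
  arr : s'.arr = s.arr
  le : s'.reg 26 ≤ m
  index : i = m - s'.reg 26
  res : s'.reg 23 = scan s.arr b (s'.reg 26)

theorem scanProg_spec (hb : c.Big) {m : ℕ} {s : St} (hI : Inv c m V s) {p l : ℕ}
    (hp : s.reg 20 = p) (hlen : s.reg 21 = l) (hle : p + l ≤ c.G.string.length) :
    Run c scanProg s fun k s' => k ≤ 300 * (partCount c.G.string * c.G.size) ∧ Frame 22 s s' ∧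
      s'.arr = s.arr ∧ s'.reg 23 = scan s.arr (block c.G.string p l) m := by
  have hB := hb
  unfold Ctx.Big at hb
  have hn := c.G.size_pos
  have hmM := hI.gram.le_partCount
  have hM := partCount_pos c.G.string
  have hbl := block_length hle
  simp [scanProg]
  refine run_loop (i := m) (ScanInv m (block c.G.string p l) s) (250 * c.G.size) ?_ ?_ ?_
  · exact ⟨by simp, rfl, by simp, by simp, by simp [scan]⟩
  · intro i s' h
    refine ⟨by simp, fun hne => ?_⟩
    have h10 : s'.reg 10 = m := by rw [h.frame.1 _ (by norm_num), hI.count]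
    have h20 : s'.reg 20 = p := by rw [h.frame.1 _ (by norm_num), hp]
    have h21 : s'.reg 21 = l := by rw [h.frame.1 _ (by norm_num), hlen]
    simp [h10] at hne
    have hres := h.res
    have hi := h.index
    generalize ht : s'.reg 26 = t at *
    have hstep := scan.eq_2 s.arr (block c.G.string p l) t
    rw [hbl, ← hres] at hstep
    have tb : t + 1 ≤ c.bd := by omega
    have tb' : t ≤ c.bd := by omega
    by_cases h1 : s.arr 0 t = l
    swap
    · simp [ht, h20, h21, h.arr, h1, tb']
      exact ⟨by omega, by omega, i - 1, by omega, by simpa using h.frame, h.arr, by simp; omega,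
        by simp; omega, by simp [hstep, h1]⟩
    by_cases h2 : s.arr 3 t = s'.reg 23
    swap
    · simp [ht, h20, h21, h.arr, h1, h2, tb']
      exact ⟨by omega, by omega, i - 1, by omega, by simpa using h.frame, h.arr, by simp; omega,
        by simp; omega, by simp [hstep, h2]⟩
    by_cases h3 : s'.reg 23 = 0
    · rw [h3] at h2
      simp [ht, h20, h21, h.arr, h1, h2, h3, tb']
      exact ⟨by omega, by omega, i - 1, by omega, by simpa using h.frame, h.arr, by simp; omega,
        by simp; omega, by simp [hstep, h1, h2, h3]⟩
    have hq := hI.trie.lt t hne (by omega)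
    rw [← hI.gram.len t hne, h1] at hq
    simp [ht, h20, h21, h.arr, h1, h2, h3, tb']
    refine ⟨by omega, ?_⟩
    refine (charAt_spec hB (p := p + s.arr 4 t) ?_ ?_ (by omega)).mono ?_
    rotate_left
    · simp
    rotate_left
    · exact hI.len.congr fun r x _ => by simp [h.arr]
    rintro k1 s1 ⟨hk1, hf1, ha1, hch⟩
    have r26 : s1.reg 26 = t := by rw [hf1.1 _ (by norm_num)]; simpa using ht
    have r23 : s1.reg 23 = s'.reg 23 := by rw [hf1.1 _ (by norm_num)]; simp
    have hF : Frame 22 s s1 := Frame.trans (by simpa using h.frame) hf1 (by norm_num)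
    simp [h.arr] at ha1
    rw [← block_getElem? hq] at hch
    rw [hch] at hstep
    by_cases h4 : s1.reg 65 = s.arr 5 t
    · simp [r26, ha1, h4, tb']
      exact ⟨by omega, by omega, i - 1, by omega, by simpa using hF, ha1, by simp; omega,
        by simp; omega, by simp [hstep, h1, h2, h4]⟩
    · simp [r26, ha1, h4, tb']
      exact ⟨by omega, by omega, i - 1, by omega, by simpa using hF, ha1, by simp; omega,
        by simp; omega, by simp [hstep, h1, h2, h3, h4, r23]⟩
  · intro i k s' hi h h0 hk
    have h10 : s'.reg 10 = m := by rw [h.frame.1 _ (by norm_num), hI.count]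
    simp [h10] at h0
    have hle := h.le
    have hm : s'.reg 26 = m := by omega
    refine ⟨?_, h.frame, h.arr, by rw [h.res, hm]⟩
    simp at hk
    have e1 := Nat.mul_le_mul_right (250 * c.G.size) hmM
    have e2 : partCount c.G.string * (250 * c.G.size) = 250 * (partCount c.G.string * c.G.size) := by
      ring
    have e3 := Nat.mul_pos hM hn
    omega

/-! ### Comparing a block with its candidate -/

/-- Looks up the block at the position `20` of the length `21`. The result is in the register `22`,
the data for the search tree are in `23` to `25`. -/
def lookup : HProg := .list [
  scanProg,
  .ite (.reg 23)
    (.list [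
      .assign 30 (.reg 23 - 1), .assign 31 (.reg 20),
      .loop (.arr 0 (.reg 30) - 1) (.list [
        .assign 40 (.arr 1 (.reg 30)), .assign 41 (.reg 31), test,
        .ite (.reg 43)
          (.list [.assign 31 (.reg 31 + .arr 0 (.arr 1 (.reg 30))), .assign 30 (.arr 2 (.reg 30))])
          (.assign 30 (.arr 1 (.reg 30)))]),
      .assign 61 (.reg 31), charAt,
      .assign 24 (.reg 31 - .reg 20), .assign 25 (.reg 65),
      .ite (.eq (.reg 65) (.arr 1 (.reg 30))) (.assign 22 (.reg 23)) (.assign 22 0)])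
    (.assign 22 0)]

/-- The current variable is a node in the Bisection tree of the candidate `u`, and the equality of
`u` with the block has been reduced to this node. The field `occ` remembers where the node sits in
`V u`, so that a mismatch at a leaf is one of `V u`; `size` bounds the remaining depth. -/
structure LookupInv (c : Ctx) (V : ℕ → List ℕ) (m u p : ℕ) (s : St) (i : ℕ) (s' : St) : Prop where
  frame : Frame 24 s s'
  arr : ∀ r x, r < 10 → s'.arr r x = s.arr r x
  clear : ∀ x, s'.arr 10 x = 0
  lt : s'.reg 30 < m
  ge : p ≤ s'.reg 31
  le : s'.reg 31 + (V (s'.reg 30)).length ≤ p + (V u).length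
  size : (V (s'.reg 30)).length ≤ 2 ^ i
  occ : Occ (V (s'.reg 30)) (V u) (s'.reg 31 - p)
  iff : Occ (V u) c.G.string p ↔ Occ (V (s'.reg 30)) c.G.string (s'.reg 31)

/-- After an unsuccessful lookup, the registers `23` to `25` hold what `Trie.create` needs to attach
a variable for the block `b`. -/
structure LookupResult (m : ℕ) (V : ℕ → List ℕ) (a : ℕ → ℕ → ℕ) (b : List ℕ) (s : St) : Prop where
  found : s.reg 22 ≠ 0 → s.reg 22 - 1 < m ∧ V (s.reg 22 - 1) = b
  new : s.reg 22 = 0 → ∀ t < m, V t ≠ b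
  parent : s.reg 22 = 0 → s.reg 23 = scan a b m
  sep : s.reg 22 = 0 → s.reg 23 ≠ 0 → s.reg 24 < b.length ∧
    (V (s.reg 23 - 1))[s.reg 24]? ≠ some (s.reg 25) ∧ b[s.reg 24]? = some (s.reg 25)

theorem lookup_spec (hb : c.Big) {m : ℕ} {s : St} (hI : Inv c m V s) {p l : ℕ}
    (hp : s.reg 20 = p) (hlen : s.reg 21 = l) (hle : p + l ≤ c.G.string.length) :
    Run c lookup s fun k s' => k ≤ 5000 * (partCount c.G.string * c.G.size ^ 3) ∧ Frame 22 s s' ∧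
      (∀ r x, r < 10 → s'.arr r x = s.arr r x) ∧ Inv c m V s' ∧
      LookupResult m V s.arr (block c.G.string p l) s' := by
  have hB := hb
  unfold Ctx.Big at hb
  have hn := c.G.size_pos
  have hmM := hI.gram.le_partCount
  have hM := partCount_pos c.G.string
  have hbl := block_length hle
  have n1 : c.G.size ≤ c.G.size ^ 3 := Nat.le_self_pow (by norm_num) _
  have n2 : partCount c.G.string * c.G.size ≤ partCount c.G.string * c.G.size ^ 3 :=
    Nat.mul_le_mul_left _ n1
  have n3 : c.G.size ^ 3 ≤ partCount c.G.string * c.G.size ^ 3 := Nat.le_mul_of_pos_left _ hM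
  simp only [lookup, run_cons]
  refine (scanProg_spec hB hI hp hlen hle).mono ?_
  rintro k1 s1 ⟨hk1, hf1, ha1, hr1⟩
  by_cases hc : s1.reg 23 = 0
  · simp [hc]
    refine ⟨by omega, by simpa using hf1, fun r x hr => by rw [ha1], hI.congr (fun r x _ => by
      simp [ha1]) (fun x => by simp [ha1, hI.clear]) ?_, ?_⟩
    · simp [hf1.1 10 (by norm_num)]
    · constructor
      · simp
      · rintro - t ht hV
        have := scan_found hI.gram hI.trie ht ht le_rfl
        rw [hV] at this
        omega
      · exact fun _ => by simpa using hr1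
      · simp [hc]
  have hu0 := scan_le s.arr (block c.G.string p l) m
  have hul := scan_length (a := s.arr) (b := block c.G.string p l) (t := m) (by omega)
  rw [← hr1] at hu0 hul
  generalize hcc : s1.reg 23 = cand at *
  -- Candidates are stored plus one, as `0` stands for none.
  obtain ⟨u, rfl⟩ : ∃ u, cand = u + 1 := ⟨cand - 1, by omega⟩
  simp only [Nat.add_sub_cancel] at hul
  have hum : u < m := hu0
  rw [hI.gram.len u hum, hbl] at hul
  have h20 : s1.reg 20 = p := by rw [hf1.1 _ (by norm_num), hp]
  have hpos := hI.gram.pos u hum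
  simp [hcc, h20]
  refine ⟨by omega, ?_⟩
  refine run_loop (i := c.G.size) (LookupInv c V m u p s1)
    (4100 * (partCount c.G.string * c.G.size ^ 2)) ?_ ?_ ?_
  · refine ⟨by simp, by simp, fun x => by simp [ha1, hI.clear], by simpa using hum, by simp, ?_, ?_,
      ?_, ?_⟩
    · simp
    · have := string_length_lt (G := c.G)
      simp; omega
    · simp [Occ]
    · simp
  · intro i s' h
    have hI' : Inv c m V s' := hI.congr (fun r x hr => by rw [h.arr r x hr, ha1]) h.clear
      (by rw [h.frame.1 _ (by norm_num), hf1.1 _ (by norm_num)])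
    have hv := h.lt
    have hge := h.ge
    have hvle := h.le
    have hsize := h.size
    have hocc := h.occ
    have hiff := h.iff
    generalize hreg : s'.reg 30 = v at *
    generalize hx : s'.reg 31 = x at *
    have hlen := hI'.gram.len v hv
    refine ⟨by simp [hreg]; omega, fun hne => ?_⟩
    simp [hreg, hlen] at hne
    obtain ⟨hy, hz, hyz, hsp⟩ := hI'.gram.pair v hv (by omega)
    have hlyz := congrArg List.length hyz
    rw [List.length_append] at hlyz
    have hly := hI'.gram.len _ (hy.trans hv)
    obtain ⟨i, rfl⟩ : ∃ i', i = i' + 1 := by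
      refine ⟨i - 1, (Nat.sub_add_cancel (Nat.pos_of_ne_zero ?_)).symm⟩
      rintro rfl
      simp at hsize; omega
    -- The left part has length at most `2 ^ i`, and by the next line the right part is no longer
    -- than the left one.
    have hsy := bisectionSplit_le (by omega) hsize
    have hsz := le_two_mul_bisectionSplit (l := (V v).length)
    have hoyz := hocc
    rw [hyz, occ_append] at hoyz
    rw [hyz, occ_append] at hiff
    simp [hreg, hx]
    refine ⟨by omega, ?_⟩
    refine (test_spec hB (m := m) (V := V) (u := s'.arr 1 v) (p := x) ?_ ?_ ?_ ?_ (by omega)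
      (by omega) ?_).mono ?_
    · exact hI'.len
    · exact hI'.gram
    · simp
    · simp
    · exact h.clear
    rintro k2 s2 ⟨hk2, hf2, ha2, hc2, ht2⟩
    have r30 : s2.reg 30 = v := by rw [hf2.1 _ (by norm_num)]; simpa using hreg
    have r31 : s2.reg 31 = x := by rw [hf2.1 _ (by norm_num)]; simpa using hx
    have hF : Frame 24 s1 s2 := Frame.trans (by simpa using h.frame) hf2 (by norm_num)
    simp only [St.set_arr] at ha2
    have hA : ∀ r x, r < 10 → s2.arr r x = s1.arr r x := fun r x hr => by
      rw [ha2 r x hr, h.arr r x hr]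
    have hmn := Nat.mul_le_mul_right (c.G.size ^ 2) hmM
    have hMn : 0 < partCount c.G.string * c.G.size ^ 2 := by positivity
    -- If the left part does not match, neither does the whole, and the descent into it retains a
    -- mismatch; if it matches, only the right part matters.
    by_cases h43 : s2.reg 43 = 0
    · have hno : ¬ Occ (V (s'.arr 1 v)) c.G.string x := fun ho => (ht2.2 ho) h43
      simp [h43, r30, ha2]
      refine ⟨by omega, by omega, i, by omega, by simpa using hF, hA, hc2, by simp; omega,
        by simpa [r31] using hge, by simp [r31]; omega, by simp; omega, by simpa [r31] using hoyz.1,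
        ?_⟩
      simp [r31, hiff, hno]
    · have hyes := ht2.1 h43
      simp [h43, r30, r31, ha2, hly]
      refine ⟨by omega, by omega, by omega, i, by omega, by simpa using hF, hA, hc2, by simp; omega,
        by simp; omega, by simp; omega, by simp; omega, ?_, ?_⟩
      · have := hoyz.2
        rw [← Nat.sub_add_comm hge] at this
        simpa using this
      · simp [hiff, hyes]
  · intro i k s' hi h h0 hk
    have hI' : Inv c m V s' := hI.congr (fun r x hr => by rw [h.arr r x hr, ha1]) h.clear
      (by rw [h.frame.1 _ (by norm_num), hf1.1 _ (by norm_num)])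
    have hv := h.lt
    have hge := h.ge
    have hvle := h.le
    have hocc := h.occ
    have hiff := h.iff
    generalize hreg : s'.reg 30 = v at *
    generalize hx : s'.reg 31 = x at *
    have hlen := hI'.gram.len v hv
    have hvpos := hI'.gram.pos v hv
    simp [hreg, hlen] at h0
    have hv1 : (V v).length = 1 := by omega
    obtain ⟨hVv, -⟩ := hI'.gram.letter v hv hv1
    rw [hVv, occ_singleton] at hocc hiff
    refine (charAt_spec hB (p := x) ?_ ?_ (by omega)).mono ?_
    rotate_left
    · simp
    rotate_left
    · exact hI'.len
    rintro k2 s2 ⟨hk2, hf2, ha2, hch⟩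
    simp only [St.set_arr] at ha2
    have r30 : s2.reg 30 = v := by rw [hf2.1 _ (by norm_num)]; simpa using hreg
    have r31 : s2.reg 31 = x := by rw [hf2.1 _ (by norm_num)]; simpa using hx
    have hF : Frame 24 s1 s2 := Frame.trans (by simpa using h.frame) hf2 (by norm_num)
    have r20 : s2.reg 20 = p := by rw [hF.1 _ (by norm_num), h20]
    have r23 : s2.reg 23 = u + 1 := by rw [hF.1 _ (by norm_num), hcc]
    have hF' : Frame 22 s s2 := hf1.trans hF (by norm_num)
    have hA : ∀ r x, r < 10 → s2.arr r x = s.arr r x := fun r x hr => by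
      rw [ha2, h.arr r x hr, ha1]
    have hcl : ∀ x, s2.arr 10 x = 0 := fun x => by rw [ha2]; exact h.clear x
    have hkk : k ≤ 4200 * (partCount c.G.string * c.G.size ^ 3) := by
      have e : c.G.size * (4100 * (partCount c.G.string * c.G.size ^ 2)) =
        4100 * (partCount c.G.string * c.G.size ^ 3) := by ring
      rw [e] at hk
      simp at hk
      omega
    rw [hch] at hiff
    have hin : x - p < l := by omega
    have hbx : (block c.G.string p l)[x - p]? = some (s2.reg 65) := by
      rw [block_getElem? hin, Nat.add_sub_cancel' hge, hch]
    by_cases h65 : s2.reg 65 = s'.arr 1 v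
    · have hVu : V u = block c.G.string p l := by
        rw [← hul]
        exact (occ_iff_block (by omega)).1 (hiff.2 (by rw [h65]))
      simp [r30, r31, r20, r23, ha2, h65]
      refine ⟨by omega, by omega, by simpa using hF', fun r x hr => by rw [← ha2, hA r x hr],
        hI.congr (by simpa using hA) (by simpa using hcl) ?_, ?_⟩
      · simp [hF'.1 10 (by norm_num)]
      · constructor <;> simp [hum, hVu]
    · simp [r30, r31, r20, r23, ha2, h65]
      refine ⟨by omega, by omega, by simpa using hF', fun r x hr => by rw [← ha2, hA r x hr],
        hI.congr (by simpa using hA) (by simpa using hcl) ?_, ?_⟩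
      · simp [hF'.1 10 (by norm_num)]
      · have hne : (V u)[x - p]? ≠ some (s2.reg 65) := by
          rw [hocc]
          simpa using Ne.symm h65
        constructor
        · simp
        · rintro - t ht hV
          have := scan_found hI.gram hI.trie ht ht le_rfl
          rw [hV, ← hr1] at this
          -- A variable for the block would have been the candidate of the scan, but the candidate
          -- has just been refuted.
          obtain rfl : u = t := by omega
          exact hne (hV ▸ hbx)
        · simp [r23, hr1]
        · refine fun _ _ => ⟨by simpa [hbl] using hin, by simpa [r23] using hne, hbx⟩

end BisectionRAM

namespace BisectionRAM

variable {c : Ctx} {V : ℕ → List ℕ}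

/-! ### The length of the left part -/

theorem bisectionSplit_eq {l k : ℕ} (h1 : 2 ^ k < l) (h2 : l ≤ 2 ^ (k + 1)) :
    bisectionSplit l = 2 ^ k := by
  have h0 : 0 < 2 ^ k := by positivity
  have h : Nat.log 2 (l - 1) = k :=
    (Nat.log_eq_iff (.inr ⟨by norm_num, by omega⟩)).2 ⟨by omega, by omega⟩
  rw [bisectionSplit, h]

/-- Computes the length of the left part of a string of the length `13`, in the register `14`. -/
def splitLength : HProg := .list [.assign 14 1,
  .loop (.lt (.reg 14 + .reg 14) (.reg 13)) (.assign 14 (.reg 14 + .reg 14))]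

structure SplitInv (n l : ℕ) (s : St) (i : ℕ) (s' : St) : Prop where
  frame : Frame 14 s s'
  arr : s'.arr = s.arr
  le : i ≤ n
  pow : s'.reg 14 = 2 ^ (n - i)
  lt : s'.reg 14 < l

theorem splitLength_spec (hb : c.Big) {s : St} {l : ℕ} (hl : s.reg 13 = l) (h2 : 2 ≤ l)
    (hlN : l ≤ c.G.string.length) :
    Run c splitLength s fun k s' => k ≤ 30 * c.G.size ∧ Frame 14 s s' ∧ s'.arr = s.arr ∧
      s'.reg 14 = bisectionSplit l := by
  unfold Ctx.Big at hb
  have hn := c.G.size_pos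
  have hlt := string_length_lt (G := c.G)
  simp [splitLength]
  refine ⟨by omega, ?_⟩
  refine run_loop (i := c.G.size) (SplitInv c.G.size l s) 10 ?_ ?_ ?_
  · exact ⟨by simp, rfl, le_rfl, by simp, by simp; omega⟩
  · intro i s' h
    have h13 : s'.reg 13 = l := by rw [h.frame.1 _ (by norm_num), hl]
    have hp := h.pow
    have hle := h.le
    have hlt' := h.lt
    refine ⟨by simp; omega, fun hne => ?_⟩
    simp [h13] at hne
    have hi : i ≠ 0 := by
      rintro rfl
      rw [Nat.sub_zero] at hp
      omega
    simp
    refine ⟨by omega, i - 1, by omega, by simpa using h.frame, h.arr, by omega, ?_, by simpa using hne⟩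
    rw [show c.G.size - (i - 1) = c.G.size - i + 1 by omega, pow_succ']
    simp; omega
  · intro i k s' hi h h0 hk
    have h13 : s'.reg 13 = l := by rw [h.frame.1 _ (by norm_num), hl]
    simp [h13] at h0
    simp at hk
    have hp := h.pow
    have hlt' := h.lt
    refine ⟨by omega, h.frame, h.arr, ?_⟩
    rw [hp]
    refine (bisectionSplit_eq (by omega) ?_).symm
    rw [pow_succ']; omega

/-! ### The stack of blocks for which the grammar has no variable yet -/

/-- The field `lt` makes the stacked blocks distinct. The bottom block is all of `S`, so when the
stack becomes empty the newest variable derives `S`, as the last variable of a straight line program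
must. -/
structure Stack (S : List ℕ) (m : ℕ) (V : ℕ → List ℕ) (a : ℕ → ℕ → ℕ) (d : ℕ) : Prop where
  le : ∀ e < d, a 6 e + a 7 e ≤ S.length
  pos : ∀ e < d, 0 < a 7 e
  part : ∀ e < d, BisectionPart S (block S (a 6 e) (a 7 e))
  new : ∀ e < d, ∀ t < m, V t ≠ block S (a 6 e) (a 7 e)
  lt : ∀ e < d, ∀ e' < e, a 7 e < a 7 e'
  bottom : 0 < d → a 6 0 = 0 ∧ a 7 0 = S.length
  top : d = 0 → 0 < m ∧ V (m - 1) = S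

/-- Variables are distinct by `hinj`, stacked blocks by their lengths, and a stacked block has no
variable; together they inject into the strings of the construction. -/
theorem Stack.add_le {S : List ℕ} {m d : ℕ} {a : ℕ → ℕ → ℕ} (h : Stack S m V a d)
    (hpart : ∀ t < m, BisectionPart S (V t)) (hinj : ∀ t < m, ∀ t' < m, V t = V t' → t = t') :
    m + d ≤ partCount S := by
  set f : ℕ → List ℕ := fun k => if k < m then V k else block S (a 6 (k - m)) (a 7 (k - m)) with hf
  have hf' : Set.InjOn f (Finset.range (m + d)) := by
    intro k hk k' hk' heq
    simp at hk hk'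
    simp only [hf] at heq
    split_ifs at heq with h1 h2 h2
    · exact hinj k h1 k' h2 heq
    · exact absurd heq (h.new _ (by omega) k h1)
    · exact absurd heq.symm (h.new _ (by omega) k' h2)
    · have := congrArg List.length heq
      rw [block_length (h.le _ (by omega)), block_length (h.le _ (by omega))] at this
      rcases lt_trichotomy (k - m) (k' - m) with h3 | h3 | h3
      · have := h.lt _ (by omega) _ h3; omega
      · omega
      · have := h.lt _ (by omega) _ h3; omega
  have h1 : (Finset.image f (Finset.range (m + d))).card = m + d := by
    rw [Finset.card_image_of_injOn hf', Finset.card_range]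
  rw [← h1, ← Set.ncard_coe_finset]
  refine Set.ncard_le_ncard (fun u hu => ?_) (parts_finite S)
  simp only [Finset.coe_image, Set.mem_image] at hu
  obtain ⟨k, hk, rfl⟩ := hu
  simp at hk
  simp only [hf]
  split_ifs with h1
  · exact hpart k h1
  · exact h.part _ (by omega)

theorem Stack.congr {S : List ℕ} {m d : ℕ} {a a' : ℕ → ℕ → ℕ} (h : Stack S m V a d)
    (ha : ∀ r x, r < 10 → a' r x = a r x) : Stack S m V a' d := by
  have h6 : a' 6 = a 6 := funext fun x => ha 6 x (by norm_num)
  have h7 : a' 7 = a 7 := funext fun x => ha 7 x (by norm_num)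
  obtain ⟨h1, h2, h3, h4, h5, h8, h9⟩ := h
  rw [← h6, ← h7] at *
  exact ⟨h1, h2, h3, h4, h5, h8, h9⟩

theorem Stack.push {S : List ℕ} {m d p l : ℕ} {a a' : ℕ → ℕ → ℕ} (h : Stack S m V a d) (hd : 0 < d)
    (ha6 : ∀ x < d, a' 6 x = a 6 x) (ha7 : ∀ x < d, a' 7 x = a 7 x) (hp : a' 6 d = p)
    (hl : a' 7 d = l) (hle : p + l ≤ S.length) (hpos : 0 < l) (hpart : BisectionPart S (block S p l))
    (hnew : ∀ t < m, V t ≠ block S p l) (hlt : l < a 7 (d - 1)) : Stack S m V a' (d + 1) := by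
  have key : ∀ e < d + 1, (a' 6 e = a 6 e ∧ a' 7 e = a 7 e ∧ e < d) ∨ e = d := fun e he => by
    rcases Nat.lt_succ_iff_lt_or_eq.1 he with h | h
    · exact .inl ⟨ha6 e h, ha7 e h, h⟩
    · exact .inr h
  have hlt' : ∀ e < d, l < a 7 e := fun e he => by
    rcases Nat.eq_or_lt_of_le (Nat.le_sub_one_of_lt he) with h1 | h1
    · rwa [h1]
    · exact hlt.trans (h.lt _ (by omega) e h1)
  constructor
  · intro e he
    rcases key e he with ⟨h1, h2, h3⟩ | rfl
    · rw [h1, h2]; exact h.le e h3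
    · rw [hp, hl]; exact hle
  · intro e he
    rcases key e he with ⟨h1, h2, h3⟩ | rfl
    · rw [h2]; exact h.pos e h3
    · rw [hl]; exact hpos
  · intro e he
    rcases key e he with ⟨h1, h2, h3⟩ | rfl
    · rw [h1, h2]; exact h.part e h3
    · rw [hp, hl]; exact hpart
  · intro e he
    rcases key e he with ⟨h1, h2, h3⟩ | rfl
    · rw [h1, h2]; exact h.new e h3
    · rw [hp, hl]; exact hnew
  · intro e he e' he'
    rw [ha7 e' (by omega)]
    rcases key e he with ⟨h1, h2, h3⟩ | rfl
    · rw [h2]; exact h.lt e h3 e' he'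
    · rw [hl]; exact hlt' e' he'
  · intro _
    rw [ha6 0 hd, ha7 0 hd]
    exact h.bottom hd
  · omega

/-- The strings after a variable for `b` has been added. -/
def extend (V : ℕ → List ℕ) (m : ℕ) (b : List ℕ) (t : ℕ) : List ℕ := if t = m then b else V t

theorem extend_self {m : ℕ} {b : List ℕ} : extend V m b m = b := if_pos rfl

theorem extend_of_lt {m t : ℕ} {b : List ℕ} (h : t < m) : extend V m b t = V t := if_neg h.ne

theorem Gram.create {S b : List ℕ} {m : ℕ} {a a' : ℕ → ℕ → ℕ} (h : Gram S m V a)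
    (ha : ∀ r x, r < 6 → x < m → a' r x = a r x) (hlen : a' 0 m = b.length) (hpos : 0 < b.length)
    (hl : b.length = 1 → b = [a' 1 m] ∧ a' 2 m = 0)
    (hp : b.length ≠ 1 → a' 1 m < m ∧ a' 2 m < m ∧ b = V (a' 1 m) ++ V (a' 2 m) ∧
      (V (a' 1 m)).length = bisectionSplit b.length)
    (hpart : BisectionPart S b) (hnew : ∀ t < m, V t ≠ b) : Gram S (m + 1) (extend V m b) a' := by
  constructor
  · intro t ht
    rcases Nat.lt_succ_iff_lt_or_eq.1 ht with h1 | rfl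
    · rw [extend_of_lt h1, ha _ _ (by norm_num) h1]; exact h.len t h1
    · rw [extend_self]; exact hlen
  · intro t ht
    rcases Nat.lt_succ_iff_lt_or_eq.1 ht with h1 | rfl
    · rw [extend_of_lt h1]; exact h.pos t h1
    · rw [extend_self]; exact hpos
  · intro t ht
    rcases Nat.lt_succ_iff_lt_or_eq.1 ht with h1 | rfl
    · rw [extend_of_lt h1, ha _ _ (by norm_num) h1, ha _ _ (by norm_num) h1]; exact h.letter t h1
    · rw [extend_self]; exact hl
  · intro t ht
    rcases Nat.lt_succ_iff_lt_or_eq.1 ht with h1 | rfl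
    · rw [extend_of_lt h1, ha _ _ (by norm_num) h1, ha _ _ (by norm_num) h1]
      intro h2
      obtain ⟨h3, h4, h5⟩ := h.pair t h1 h2
      rw [extend_of_lt (h3.trans h1), extend_of_lt (h4.trans h1)]
      exact ⟨h3, h4, h5⟩
    · rw [extend_self]
      intro h2
      obtain ⟨h3, h4, h5⟩ := hp h2
      rw [extend_of_lt h3, extend_of_lt h4]
      exact ⟨h3, h4, h5⟩
  · intro t ht
    rcases Nat.lt_succ_iff_lt_or_eq.1 ht with h1 | rfl
    · rw [extend_of_lt h1]; exact h.part t h1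
    · rw [extend_self]; exact hpart
  · intro t ht t' ht'
    rcases Nat.lt_succ_iff_lt_or_eq.1 ht with h1 | rfl <;>
      rcases Nat.lt_succ_iff_lt_or_eq.1 ht' with h2 | rfl
    · rw [extend_of_lt h1, extend_of_lt h2]; exact h.inj t h1 t' h2
    · rw [extend_of_lt h1, extend_self]; exact fun h3 => absurd h3 (hnew t h1)
    · rw [extend_of_lt h2, extend_self]; exact fun h3 => absurd h3.symm (hnew t' h2)
    · exact fun _ => rfl

theorem Trie.create {m : ℕ} {b : List ℕ} {a a' : ℕ → ℕ → ℕ} (h : Trie m V a)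
    (ha : ∀ r x, r < 6 → x < m → a' r x = a r x) (hscan : a' 3 m = scan a b m)
    (hsep : a' 3 m ≠ 0 → a' 4 m < b.length ∧ (V (a' 3 m - 1))[a' 4 m]? ≠ some (a' 5 m) ∧
      b[a' 4 m]? = some (a' 5 m)) : Trie (m + 1) (extend V m b) a' := by
  constructor
  · intro t ht
    rcases Nat.lt_succ_iff_lt_or_eq.1 ht with h1 | rfl
    · rw [extend_of_lt h1, ha _ _ (by norm_num) h1, scan_congr ha _ h1.le]; exact h.scan_eq t h1
    · rw [extend_self, scan_congr ha _ le_rfl]; exact hscan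
  · intro t ht
    rcases Nat.lt_succ_iff_lt_or_eq.1 ht with h1 | rfl
    · rw [extend_of_lt h1, ha _ _ (by norm_num) h1, ha _ _ (by norm_num) h1]; exact h.lt t h1
    · rw [extend_self]; exact fun h1 => (hsep h1).1
  · intro t ht h0
    rcases Nat.lt_succ_iff_lt_or_eq.1 ht with h1 | rfl
    · rw [ha _ _ (by norm_num) h1] at h0
      have h2 := scan_le a (V t) t
      rw [← h.scan_eq t h1] at h2
      rw [ha _ _ (by norm_num) h1, ha _ _ (by norm_num) h1, ha _ _ (by norm_num) h1,
        extend_of_lt (by omega)]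
      exact h.sep t h1 h0
    · have h2 := scan_le a b t
      rw [← hscan] at h2
      rw [extend_of_lt (by omega)]
      exact (hsep h0).2.1
  · intro t ht
    rcases Nat.lt_succ_iff_lt_or_eq.1 ht with h1 | rfl
    · rw [extend_of_lt h1, ha _ _ (by norm_num) h1, ha _ _ (by norm_num) h1,
        ha _ _ (by norm_num) h1]
      exact h.get t h1
    · rw [extend_self]; exact fun h1 => (hsep h1).2.2

theorem Stack.pop {S b : List ℕ} {m d : ℕ} {a a' : ℕ → ℕ → ℕ} (h : Stack S m V a (d + 1))
    (ha6 : a' 6 = a 6) (ha7 : a' 7 = a 7) (hb : b = block S (a 6 d) (a 7 d)) :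
    Stack S (m + 1) (extend V m b) a' d := by
  constructor <;> try simp only [ha6, ha7]
  · exact fun e he => h.le e (by omega)
  · exact fun e he => h.pos e (by omega)
  · exact fun e he => h.part e (by omega)
  · intro e he t ht
    rcases Nat.lt_succ_iff_lt_or_eq.1 ht with h1 | rfl
    · rw [extend_of_lt h1]; exact h.new e (by omega) t h1
    · rw [extend_self, hb]
      -- The remaining blocks are strictly longer than the popped one, so the new variable does not
      -- derive any of them.
      intro heq
      have := congrArg List.length heq
      rw [block_length (h.le _ (by omega)), block_length (h.le _ (by omega))] at this
      have := h.lt d (by omega) e he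
      omega
  · exact fun e he => h.lt e (by omega)
  · exact fun _ => h.bottom (by omega)
  -- The popped block was the bottom one, that is, `S` itself.
  · rintro rfl
    refine ⟨by omega, ?_⟩
    obtain ⟨h1, h2⟩ := h.bottom (by omega)
    rw [Nat.add_sub_cancel, extend_self, hb, h1, h2]
    simp [block]

/-! ### The main loop -/

/-- Adds a variable with the right-hand side `15`, `16` for the block on the top of the stack. -/
def create : HProg := .list [
  .store 0 (.reg 10) (.reg 13), .store 1 (.reg 10) (.reg 15), .store 2 (.reg 10) (.reg 16),
  .store 3 (.reg 10) (.reg 23), .store 4 (.reg 10) (.reg 24), .store 5 (.reg 10) (.reg 25),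
  .assign 10 (.reg 10 + 1), .assign 11 (.reg 11 - 1)]

/-- Pushes the block at the position `20` of the length `21`. -/
def push : HProg := .list [.store 6 (.reg 11) (.reg 20), .store 7 (.reg 11) (.reg 21),
  .assign 11 (.reg 11 + 1)]

/-- The index is what is missing from `2 * m + d` to twice the number of strings, with `d` the
height of the stack. A push raises `d` by one; a creation raises `m` by one and lowers `d` by one.
So either uses up exactly one unit. -/
structure MainInv (c : Ctx) (i : ℕ) (s : St) : Prop where
  out : s.out = []
  state : ∃ m V, Inv c m V s ∧ Stack c.G.string m V s.arr (s.reg 11) ∧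
    i + 2 * m + s.reg 11 = 2 * partCount c.G.string

theorem create_spec (hb : c.Big) {m d i p l : ℕ} {s : St} (hI : Inv c m V s)
    (hS : Stack c.G.string m V s.arr (d + 1)) (hd : s.reg 11 = d + 1) (hout : s.out = [])
    (hi : i + 2 * m + (d + 1) = 2 * partCount c.G.string) (hp : s.arr 6 d = p) (hl : s.arr 7 d = l)
    (h13 : s.reg 13 = l)
    (hletter : l = 1 → block c.G.string p l = [s.reg 15] ∧ s.reg 16 = 0)
    (hpair : l ≠ 1 → s.reg 15 < m ∧ s.reg 16 < m ∧
      block c.G.string p l = V (s.reg 15) ++ V (s.reg 16) ∧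
      (V (s.reg 15)).length = bisectionSplit l)
    (hscan : s.reg 23 = scan s.arr (block c.G.string p l) m)
    (hsep : s.reg 23 ≠ 0 → s.reg 24 < (block c.G.string p l).length ∧
      (V (s.reg 23 - 1))[s.reg 24]? ≠ some (s.reg 25) ∧
      (block c.G.string p l)[s.reg 24]? = some (s.reg 25)) :
    Run c create s fun k s' => k ≤ 100 ∧ ∃ i' < i, MainInv c i' s' := by
  have hB := hb
  unfold Ctx.Big at hb
  have hadd := hS.add_le hI.gram.part hI.gram.inj
  have hle := hS.le d (by omega)
  have hpos := hS.pos d (by omega)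
  have hpart := hS.part d (by omega)
  have hnew := hS.new d (by omega)
  rw [hp, hl] at hle hpart hnew
  rw [hl] at hpos
  have hbl := block_length hle
  have h10 := hI.count
  simp [create, h10, hd]
  refine ⟨by omega, by omega, by omega, i - 1, by omega, hout, m + 1, extend V m (block c.G.string p l),
    ⟨?_, ?_, ?_, ?_, ?_⟩, ?_, ?_⟩
  · intro j hj hjN
    simpa using hI.len j hj hjN
  · refine hI.gram.create ?_ ?_ (by omega) ?_ ?_ hpart hnew
    · intro r x hr hx
      simp [hx.ne]
    · simp [hbl, h13]
    · simpa [hbl] using hletter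
    · simpa [hbl] using hpair
  · refine hI.trie.create ?_ ?_ ?_
    · intro r x hr hx
      simp [hx.ne]
    · simpa using hscan
    · simpa using hsep
  · intro x
    simpa using hI.clear x
  · simp
  · change Stack _ _ _ _ d
    refine hS.pop ?_ ?_ (by rw [hp, hl]) <;> funext x <;> simp
  · simp; omega

theorem push_spec (hb : c.Big) {m d i p l : ℕ} {s : St} (hI : Inv c m V s)
    (hS : Stack c.G.string m V s.arr d) (hd : s.reg 11 = d) (hd0 : 0 < d) (hout : s.out = [])
    (hi : i + 2 * m + d = 2 * partCount c.G.string) (hp : s.reg 20 = p) (hl : s.reg 21 = l)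
    (hle : p + l ≤ c.G.string.length) (hpos : 0 < l)
    (hpart : BisectionPart c.G.string (block c.G.string p l))
    (hnew : ∀ t < m, V t ≠ block c.G.string p l) (hlt : l < s.arr 7 (d - 1)) :
    Run c push s fun k s' => k ≤ 100 ∧ ∃ i' < i, MainInv c i' s' := by
  have hB := hb
  unfold Ctx.Big at hb
  have hadd := hS.add_le hI.gram.part hI.gram.inj
  have hS' : Stack c.G.string m V ((s.put 6 d p).put 7 d l).arr (d + 1) :=
    hS.push hd0 (fun x hx => by simp [hx.ne]) (fun x hx => by simp [hx.ne]) (by simp) (by simp)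
      hle hpos hpart hnew hlt
  have hadd' := hS'.add_le hI.gram.part hI.gram.inj
  simp [push, hd, hp, hl]
  refine ⟨by omega, by omega, i - 1, by omega, hout, m, V, ⟨?_, ?_, ?_, ?_, ?_⟩, ?_, ?_⟩
  · intro j hj hjN
    simpa using hI.len j hj hjN
  · obtain ⟨h1, h2, h3, h4, h5, h6⟩ := hI.gram
    exact ⟨by simpa using h1, h2, by simpa using h3, by simpa using h4, h5, h6⟩
  · refine hI.trie.congr fun r x hr _ => ?_
    simp
    repeat rw [if_neg (by omega)]
  · intro x
    simpa using hI.clear x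
  · simpa using hI.count
  · simpa using hS'
  · simp; omega

/-- One round of the main loop, for the block on the top of the stack. -/
def mainBody : HProg := .list [
  .assign 12 (.arr 6 (.reg 11 - 1)), .assign 13 (.arr 7 (.reg 11 - 1)),
  .ite (.eq (.reg 13) 1)
    (.list [.assign 20 (.reg 12), .assign 21 (.reg 13), lookup, .assign 61 (.reg 12), charAt,
      .assign 15 (.reg 65), .assign 16 0, create])
    (.list [splitLength, .assign 20 (.reg 12), .assign 21 (.reg 14), lookup,
      .ite (.reg 22)
        (.list [.assign 15 (.reg 22 - 1), .assign 20 (.reg 12 + .reg 14),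
          .assign 21 (.reg 13 - .reg 14), lookup,
          .ite (.reg 22)
            (.list [.assign 16 (.reg 22 - 1), .assign 20 (.reg 12), .assign 21 (.reg 13), lookup,
              create])
            push])
        push])]

set_option maxHeartbeats 1000000 in
-- Three lookups of at most `5000` units each dominate the cost. A block whose half is missing stays
-- on the stack and is examined again once that half has a variable.
theorem mainBody_spec (hb : c.Big) {i : ℕ} {s : St} (h : MainInv c i s) (h0 : s.reg 11 ≠ 0) :
    Run c mainBody s fun k s' =>
      k ≤ 16000 * (partCount c.G.string * c.G.size ^ 3) ∧ ∃ i' < i, MainInv c i' s' := by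
  have hB := hb
  unfold Ctx.Big at hb
  have hn := c.G.size_pos
  have hM := partCount_pos c.G.string
  have n1 : c.G.size ≤ c.G.size ^ 3 := Nat.le_self_pow (by norm_num) _
  have n3 : c.G.size ^ 3 ≤ partCount c.G.string * c.G.size ^ 3 := Nat.le_mul_of_pos_left _ hM
  obtain ⟨hout, m, V, hI, hS, hi⟩ := h
  generalize hd : s.reg 11 = d at *
  obtain ⟨d, rfl⟩ : ∃ d', d = d' + 1 := ⟨d - 1, by omega⟩
  have hadd := hS.add_le hI.gram.part hI.gram.inj
  have hle := hS.le d (by omega)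
  have hpos := hS.pos d (by omega)
  have hpart := hS.part d (by omega)
  have hnew := hS.new d (by omega)
  have hbl := block_length hle
  generalize hp : s.arr 6 d = p at *
  generalize hl : s.arr 7 d = l at *
  simp [mainBody, hd, hp, hl]
  refine ⟨by omega, by omega, fun h1 => ?_, fun h1 => ?_⟩
  · subst h1
    refine (lookup_spec hB (m := m) (V := V) (p := p) (l := 1) ?_ ?_ ?_ hle).mono ?_
    · exact hI.congr (by simp) (by simpa using hI.clear) (by simp)
    · simp
    · simp
    rintro k1 s1 ⟨hk1, hf1, ha1, hI1, hR⟩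
    have r12 : s1.reg 12 = p := by rw [hf1.1 _ (by norm_num)]; simp
    simp only [r12]
    refine (charAt_spec hB (p := p) ?_ ?_ (by omega)).mono ?_
    rotate_left
    · simp
    rotate_left
    · exact hI1.len
    rintro k2 s2 ⟨hk2, hf2, ha2, hch⟩
    simp only [St.set_arr] at ha2
    have hA : ∀ r x, r < 10 → s2.arr r x = s.arr r x := fun r x hr => by
      rw [ha2, ha1 r x hr]; simp
    have hreg : ∀ x < 26, s2.reg x = s1.reg x := fun x hx => by
      rw [hf2.1 _ (by omega)]; simp; omega
    have hreg' : ∀ x < 12, s2.reg x = s.reg x := fun x hx => by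
      rw [hreg x (by omega), hf1.1 _ (by omega)]; simp
      repeat rw [if_neg (by omega)]
    -- The lookup must fail, since stacked blocks have no variable; it is made only for the search
    -- tree data.
    have hz : s1.reg 22 = 0 := by
      by_contra hne
      obtain ⟨h1, h2⟩ := hR.found hne
      exact hnew _ h1 h2
    refine Run.mono (create_spec hB (m := m) (V := V) (d := d) (i := i) (p := p) (l := 1)
      ?_ ?_ ?_ ?_ hi ?_ ?_ ?_ ?_ ?_ ?_ ?_) ?_
    · refine hI1.congr (fun r x hr => by simp [ha2]) (fun x => by simp [ha2, hI1.clear]) ?_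
      simp [hreg]
    · exact hS.congr fun r x hr => by simp [hA r x hr]
    · simp [hreg', hd]
    · rw [St.set_out, St.set_out, hf2.2, St.set_out, hf1.2]; exact hout
    · simp [hA, hp]
    · simp [hA, hl]
    · simp [hreg, hf1.1]
    · refine fun _ => ⟨?_, by simp⟩
      refine List.ext_getElem? fun k => ?_
      rcases Nat.eq_zero_or_pos k with rfl | hk
      · rw [block_getElem? one_pos, Nat.add_zero, hch]; simp
      · rw [List.getElem?_eq_none (by omega), List.getElem?_eq_none (by rw [List.length_singleton]; exact hk)]
    · exact fun h => absurd rfl h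
    · have := hR.parent hz
      simp only [St.set_reg, St.set_arr]
      norm_num
      rw [hreg _ (by norm_num), this]
      exact (scan_congr (fun r x hr _ => by rw [hA r x (by omega)]; simp) _ le_rfl).symm
    · have := hR.sep hz
      simp
      rw [hreg _ (by norm_num), hreg _ (by norm_num), hreg _ (by norm_num)]
      simpa using this
    · rintro k3 s3 ⟨hk3, h3⟩
      exact ⟨by omega, h3⟩
  · have h2 : 2 ≤ l := by omega
    refine (splitLength_spec hB (l := l) (by simp) h2 (by omega)).mono ?_
    rintro k0 s0 ⟨hk0, hf0, ha0, h14⟩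
    simp at ha0
    have e11 : s0.reg 11 = d + 1 := by rw [hf0.1 _ (by norm_num)]; simpa using hd
    have e12 : s0.reg 12 = p := by rw [hf0.1 _ (by norm_num)]; simp
    have e13 : s0.reg 13 = l := by rw [hf0.1 _ (by norm_num)]; simp
    have hI0 : Inv c m V s0 := hI.congr (by simp [ha0]) (by simp [ha0, hI.clear])
      (by rw [hf0.1 _ (by norm_num)]; simp)
    have hout0 : s0.out = [] := by rw [hf0.2]; exact hout
    have hlt := bisectionSplit_lt h2
    have hsp := bisectionSplit_pos l
    have hsplit := block_split (x := c.G.string) (p := p) hlt.le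
    have hpl := hpart.left (by rw [hbl]; exact h2)
    have hpr := hpart.right (by rw [hbl]; exact h2)
    rw [hbl, block_take hlt.le] at hpl
    rw [hbl, block_drop] at hpr
    generalize hsl : bisectionSplit l = q at *
    simp only [e12, h14]
    refine (lookup_spec hB (m := m) (V := V) (p := p) (l := q) ?_ ?_ ?_ (by omega)).mono ?_
    · exact hI0.congr (by simp) (by simpa using hI0.clear) (by simp)
    · simp
    · simp
    rintro k1 s1 ⟨hk1, hf1, ha1, hI1, hR1⟩
    have f20 : s1.reg 20 = p := by rw [hf1.1 _ (by norm_num)]; simp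
    have f21 : s1.reg 21 = q := by rw [hf1.1 _ (by norm_num)]; simp
    have f1 : ∀ x < 20, s1.reg x = s0.reg x := fun x hx => by
      rw [hf1.1 _ (by omega)]; simp
      repeat rw [if_neg (by omega)]
    have hA1 : ∀ r x, r < 10 → s1.arr r x = s.arr r x := fun r x hr => by
      rw [ha1 r x hr]; simp [ha0]
    have hout1 : s1.out = [] := by rw [hf1.2]; exact hout0
    refine ⟨fun hy => ?_, fun hy => ?_⟩
    swap
    · refine (push_spec hB hI1 (hS.congr hA1) (by rw [f1 _ (by norm_num), e11]) (by omega) hout1 hi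
        f20 f21 (by omega) hsp hpl (hR1.new hy) (by rw [hA1 _ _ (by norm_num)]; simpa [hl] using hlt)
        ).mono ?_
      rintro k3 s3 ⟨hk3, h3⟩
      exact ⟨by omega, h3⟩
    obtain ⟨hy1, hy2⟩ := hR1.found hy
    simp [f1, e12, h14, e13]
    refine ⟨by omega, by omega, ?_⟩
    refine (lookup_spec hB (m := m) (V := V) (p := p + q) (l := l - q) ?_ ?_ ?_ (by omega)).mono ?_
    · exact hI1.congr (by simp) (by simpa using hI1.clear) (by simp)
    · simp
    · simp
    rintro k2 s2 ⟨hk2, hf2, ha2, hI2, hR2⟩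
    have g20 : s2.reg 20 = p + q := by rw [hf2.1 _ (by norm_num)]; simp
    have g21 : s2.reg 21 = l - q := by rw [hf2.1 _ (by norm_num)]; simp
    have g15 : s2.reg 15 = s1.reg 22 - 1 := by rw [hf2.1 _ (by norm_num)]; simp
    have f2 : ∀ x < 15, s2.reg x = s0.reg x := fun x hx => by
      rw [← f1 x (by omega), hf2.1 _ (by omega)]; simp
      repeat rw [if_neg (by omega)]
    have hA2 : ∀ r x, r < 10 → s2.arr r x = s.arr r x := fun r x hr => by
      rw [ha2 r x hr]; simp [hA1 r x hr]
    have hout2 : s2.out = [] := by rw [hf2.2]; exact hout1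
    refine ⟨fun hz => ?_, fun hz => ?_⟩
    swap
    · refine (push_spec hB hI2 (hS.congr hA2) (by rw [f2 _ (by norm_num), e11]) (by omega) hout2 hi
        g20 g21 (by omega) (by omega) hpr (hR2.new hz)
        (by rw [hA2 _ _ (by norm_num)]; simp [hl]; omega)).mono ?_
      rintro k3 s3 ⟨hk3, h3⟩
      exact ⟨by omega, h3⟩
    obtain ⟨hz1, hz2⟩ := hR2.found hz
    simp [f2, e12, e13]
    refine ⟨by omega, ?_⟩
    refine (lookup_spec hB (m := m) (V := V) (p := p) (l := l) ?_ ?_ ?_ hle).mono ?_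
    · exact hI2.congr (by simp) (by simpa using hI2.clear) (by simp)
    · simp
    · simp
    rintro k3 s3 ⟨hk3, hf3, ha3, hI3, hR3⟩
    have f3 : ∀ x < 16, s3.reg x = s2.reg x := fun x hx => by
      rw [hf3.1 _ (by omega)]; simp
      repeat rw [if_neg (by omega)]
    have i16 : s3.reg 16 = s2.reg 22 - 1 := by rw [hf3.1 _ (by norm_num)]; simp
    have i15 : s3.reg 15 = s1.reg 22 - 1 := by rw [f3 _ (by norm_num), g15]
    have hA3 : ∀ r x, r < 10 → s3.arr r x = s.arr r x := fun r x hr => by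
      rw [ha3 r x hr]; simp [hA2 r x hr]
    -- As for letters, this third lookup must fail and only supplies the place of the new variable
    -- in the search tree.
    have hw : s3.reg 22 = 0 := by
      by_contra hne
      obtain ⟨h1, h2⟩ := hR3.found hne
      exact hnew _ h1 h2
    refine Run.mono (create_spec hB (d := d) (i := i) (p := p) (l := l) hI3 (hS.congr hA3)
      ?_ ?_ hi ?_ ?_ ?_ ?_ ?_ ?_ ?_) ?_
    · rw [f3 _ (by norm_num), f2 _ (by norm_num), e11]
    · rw [hf3.2]; exact hout2
    · rw [hA3 _ _ (by norm_num), hp]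
    · rw [hA3 _ _ (by norm_num), hl]
    · rw [f3 _ (by norm_num), f2 _ (by norm_num), e13]
    · exact fun h => absurd h h1
    · rw [i15, i16, hy2, hz2]
      exact fun _ => ⟨hy1, hz1, hsplit, by rw [block_length (by omega), hsl]⟩
    · have hs : ∀ r x, r < 6 → x < m → s3.arr r x = s2.arr r x :=
        fun r x hr _ => by rw [hA3 r x (by omega), hA2 r x (by omega)]
      have := hR3.parent hw
      simp only [St.set_arr] at this
      rw [this]
      exact (scan_congr hs _ le_rfl).symm
    · exact hR3.sep hw
    · rintro k4 s4 ⟨hk4, h4⟩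
      exact ⟨by omega, h4⟩

end BisectionRAM

namespace BisectionRAM

variable {c : Ctx} {V : ℕ → List ℕ} {S : List ℕ} {m : ℕ} {a : ℕ → ℕ → ℕ}

/-! ### The grammar as a straight line program -/

/-- The straight line program that the arrays `0`, `1`, `2` describe. -/
def Gram.slp (h : Gram S m V a) (hm : 0 < m) : SLP ℕ where
  size := m
  size_pos := hm
  rule i := if h1 : (V i).length = 1 then .letter (a 1 i) else
    .pair ⟨a 1 i, (h.pair i i.2 h1).1⟩ ⟨a 2 i, (h.pair i i.2 h1).2.1⟩

theorem Gram.slp_val (h : Gram S m V a) (hm : 0 < m) (t : Fin (h.slp hm).size) :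
    (h.slp hm).val t = V t := by
  obtain ⟨t, ht⟩ := t
  induction t using Nat.strong_induction_on with
  | _ t ih =>
    rw [SLP.val]
    by_cases h1 : (V t).length = 1
    · have hr : (h.slp hm).rule ⟨t, ht⟩ = .letter (a 1 t) := by simp [Gram.slp, h1]
      rw [hr, (h.letter t ht h1).1]
    · obtain ⟨hl, hr, hV, -⟩ := h.pair t ht h1
      have hrule : (h.slp hm).rule ⟨t, ht⟩ = .pair ⟨a 1 t, hl⟩ ⟨a 2 t, hr⟩ := by
        simp [Gram.slp, h1]
      rw [hrule, hV]
      exact congrArg₂ _ (ih _ hl _) (ih _ hr _)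

/-- Every string of the construction has a variable by induction from `S`: the rules cut exactly
where the Bisection does, so the halves of a derived string are derived too. -/
theorem Gram.isBisectionGrammar (h : Gram S m V a) (hm : 0 < m) (htop : V (m - 1) = S) :
    IsBisectionGrammar S (h.slp hm) where
  represents := (h.slp_val hm _).trans htop
  injective t t' heq := by
    rw [h.slp_val, h.slp_val] at heq
    exact Fin.ext (h.inj t t.2 t' t'.2 heq)
  range_val := by
    ext u
    constructor
    · rintro ⟨t, rfl⟩
      rw [h.slp_val]
      exact h.part t t.2
    · intro hu
      suffices ∃ t < m, V t = u by
        obtain ⟨t, ht, rfl⟩ := this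
        exact ⟨⟨t, ht⟩, h.slp_val hm _⟩
      induction hu with
      | root => exact ⟨m - 1, by omega, htop⟩
      | left _ h2 ih =>
        obtain ⟨t, ht, rfl⟩ := ih
        obtain ⟨hl, -, hV, hlen⟩ := h.pair t ht (by omega)
        refine ⟨a 1 t, by omega, ?_⟩
        rw [← hlen]
        exact ((congrArg (List.take _) hV).trans List.take_left).symm
      | right _ h2 ih =>
        obtain ⟨t, ht, rfl⟩ := ih
        obtain ⟨-, hr, hV, hlen⟩ := h.pair t ht (by omega)
        refine ⟨a 2 t, by omega, ?_⟩
        rw [← hlen]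
        exact ((congrArg (List.drop _) hV).trans List.drop_left).symm
  length_left := by
    rintro t ⟨l, hl⟩ ⟨r, hr⟩ hrule
    by_cases h1 : (V t).length = 1
    · simp [Gram.slp, h1] at hrule
    · simp [Gram.slp, h1] at hrule
      obtain ⟨rfl, rfl⟩ := hrule
      rw [h.slp_val, h.slp_val]
      exact (h.pair t t.2 h1).2.2.2

/-- The words that describe the rule of the variable `t`. -/
def ruleWords (a : ℕ → ℕ → ℕ) (t : ℕ) : List ℕ := [1 - if a 0 t = 1 then 1 else 0, a 1 t, a 2 t]

/-- A letter is encoded with a third word `0`, which is why `Gram.letter` also records `a 2 t = 0`;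
the output can then print the arrays unchanged. -/
theorem Gram.encode_slp (h : Gram S m V a) (hm : 0 < m) :
    (h.slp hm).encode = m :: (List.range m).flatMap (ruleWords a) := by
  rw [SLP.encode]
  refine congrArg _ ?_
  rw [← List.map_coe_finRange_eq_range, List.flatMap_map]
  refine List.flatMap_congr fun i _ => ?_
  by_cases h1 : (V i).length = 1
  · have hr : (h.slp hm).rule i = .letter (a 1 i) := by simp [Gram.slp, h1]
    rw [hr, ruleWords, h.len i i.2, if_pos h1, (h.letter i i.2 h1).2]
    rfl
  · obtain ⟨hl, hr, -⟩ := h.pair i i.2 h1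
    have hrule : (h.slp hm).rule i = .pair ⟨a 1 i, hl⟩ ⟨a 2 i, hr⟩ := by simp [Gram.slp, h1]
    rw [hrule, ruleWords, h.len i i.2, if_neg h1]
    rfl

/-- This turns the running time in terms of `partCount` into one in terms of the size of the output.
-/
theorem partCount_le_size {T : SLP ℕ} (h : IsBisectionGrammar S T) : partCount S ≤ T.size := by
  rw [partCount, ← h.range_val, ← Set.image_univ]
  refine (Set.ncard_image_le Set.finite_univ).trans ?_
  rw [Set.ncard_univ, Nat.card_fin]

end BisectionRAM

namespace BisectionRAM

variable {c : Ctx} {V : ℕ → List ℕ} {S : List ℕ} {m : ℕ} {a : ℕ → ℕ → ℕ}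

/-! ### The whole program -/

/-- Computes the lengths of the strings of the input grammar, modulo `2 ^ w`. -/
def lens : HProg := .loop (.lt (.reg 17) .size) (.list [
  .ite (.rule 0 (.reg 17))
    (.store 8 (.reg 17) (.wadd (.arr 8 (.rule 1 (.reg 17))) (.arr 8 (.rule 2 (.reg 17)))))
    (.store 8 (.reg 17) 1),
  .assign 17 (.reg 17 + 1)])

/-- Sums that wrap around remain correct modulo `2 ^ w`, and the lengths that matter are at most
`|S| < 2 ^ w`, hence exact. -/
structure LensInv (c : Ctx) (i : ℕ) (s : St) : Prop where
  frame : Frame 17 St.init s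
  arr : ∀ r x, r ≠ 8 → s.arr r x = 0
  count : s.reg 17 + i = c.G.size
  len : ∀ x < s.reg 17, s.arr 8 x = (str c.G x).length % 2 ^ c.w

theorem lens_spec (hb : c.Big) : Run c lens St.init fun k s => k ≤ 101 * c.G.size ∧
    Frame 17 St.init s ∧ (∀ r x, r ≠ 8 → s.arr r x = 0) ∧ LenOK c s := by
  unfold Ctx.Big at hb
  have hn := c.G.size_pos
  have hfits := c.fits
  refine run_loop (i := c.G.size) (LensInv c) 90 ?_ ?_ ?_
  · exact ⟨.refl, fun _ _ _ => rfl, Nat.zero_add _, fun x hx => absurd hx (Nat.not_lt_zero x)⟩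
  · intro i s h
    have hc := h.count
    refine ⟨by simp, fun hne => ?_⟩
    have hlt : s.reg 17 < c.G.size := by
      by_contra hge
      simp [hge] at hne
    have hframe := h.frame
    have harr := h.arr
    have hlen := h.len
    generalize hx : s.reg 17 = x at *
    simp [hx]
    refine ⟨hlt, fun h0 => ?_, fun h0 => ?_⟩
    · obtain ⟨hl, hr, hstr⟩ := str_pair hlt h0
      refine ⟨⟨by omega, ⟨hlt, by omega⟩, hlt, by omega⟩, by omega, i - 1, by omega,
        ?_, ?_, ?_, ?_⟩
      · simpa using hframe
      · intro r y hr
        simpa [hr] using harr r y hr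
      · simp; omega
      · intro y hy
        simp at hy ⊢
        by_cases hyx : y = x
        · rw [if_pos hyx, hyx, hlen _ hl, hlen _ hr, hstr, List.length_append, ← Nat.add_mod]
        · rw [if_neg hyx, hlen _ (by omega)]
    · refine ⟨by omega, by omega, i - 1, by omega, ?_, ?_, ?_, ?_⟩
      · simpa using hframe
      · intro r y hr
        simpa [hr] using harr r y hr
      · simp; omega
      · intro y hy
        simp at hy ⊢
        by_cases hyx : y = x
        · rw [if_pos hyx, hyx, str_letter hlt h0, List.length_singleton, Nat.mod_eq_of_lt (by omega)]
        · rw [if_neg hyx, hlen _ (by omega)]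
  · intro i k s hi h h0 hk
    simp at h0 hk
    have hc := h.count
    have hge : c.G.size ≤ s.reg 17 := by
      by_contra hlt
      simp [Nat.lt_of_not_le hlt] at h0
    refine ⟨by omega, h.frame, h.arr, fun x hx hN => ?_⟩
    rw [h.len x (by omega), Nat.mod_eq_of_lt (by omega)]

/-- Writes the grammar. -/
def output : HProg := .list [.emit (.reg 10), .assign 17 0,
  .loop (.lt (.reg 17) (.reg 10)) (.list [.emit (1 - .eq (.arr 0 (.reg 17)) 1),
    .emit (.arr 1 (.reg 17)), .emit (.arr 2 (.reg 17)), .assign 17 (.reg 17 + 1)])]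

structure OutputInv (m : ℕ) (a : ℕ → ℕ → ℕ) (i : ℕ) (s : St) : Prop where
  arr : s.arr = a
  last : s.reg 10 = m
  count : s.reg 17 + i = m
  out : s.out = m :: (List.range (s.reg 17)).flatMap (ruleWords a)

theorem output_spec (hb : c.Big) {s : St} (hout : s.out = []) (hm : s.reg 10 = m)
    (hle : m ≤ partCount c.G.string) : Run c output s fun k s' => k ≤ 90 * m + 20 ∧
      s'.out = m :: (List.range m).flatMap (ruleWords s.arr) := by
  unfold Ctx.Big at hb
  simp [output, hm]
  refine run_loop (i := m) (OutputInv m s.arr) 80 ?_ ?_ ?_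
  · exact ⟨rfl, by simpa using hm, by simp, by simp [hout]⟩
  · intro i s' h
    have hc := h.count
    refine ⟨by simp, fun hne => ?_⟩
    have hlt : s'.reg 17 < m := by
      by_contra hge
      simp [hge, h.last] at hne
    obtain ⟨harr, hlast, -, hout'⟩ := h
    simp
    refine ⟨by omega, by omega, by omega, i - 1, by omega, harr, hlast, by simp; omega, ?_⟩
    simp [hout', List.range_succ, ruleWords, harr]
  · intro i k s' hi h h0 hk
    simp [h.last] at h0
    simp at hk
    have hc := h.count
    refine ⟨by omega, ?_⟩
    rw [h.out, show s'.reg 17 = m by omega]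

/-- The program that transforms a straight line program into the Bisection grammar. -/
def bisection : HProg := .list [lens, .store 7 0 (.arr 8 (.size - 1)), .assign 11 1,
  .loop (.reg 11) mainBody, output]

theorem bisection_spec (hb : c.Big) : Run c bisection St.init fun k s =>
    k ≤ 33000 * (c.G.size ^ 3 * partCount c.G.string ^ 2) ∧
      ∃ m V a, Gram c.G.string m V a ∧ 0 < m ∧ V (m - 1) = c.G.string ∧
        s.out = m :: (List.range m).flatMap (ruleWords a) := by
  have hB := hb
  unfold Ctx.Big at hb
  have hn := c.G.size_pos
  have hN := string_length_pos (G := c.G)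
  have hM := partCount_pos c.G.string
  simp [bisection]
  refine (lens_spec hB).mono ?_
  rintro k1 s1 ⟨hk1, hf, ha, hlen⟩
  have hlast : s1.arr 8 (c.G.size - 1) = c.G.string.length := by
    rw [hlen _ (by omega) (by rw [str_last]), str_last]
  have h10 : s1.reg 10 = 0 := hf.1 _ (by norm_num)
  refine ⟨by omega, by omega, ?_⟩
  -- Initially there is no variable and one block, `S`, on the stack, which leaves `2 * M - 1`
  -- units.
  refine run_loop (i := 2 * partCount c.G.string - 1) (MainInv c)
    (16000 * (partCount c.G.string * c.G.size ^ 3) + 2) ?_ ?_ ?_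
  · refine ⟨hf.2, 0, fun _ => [], ⟨?_, ?_, ?_, ?_, ?_⟩, ?_, ?_⟩
    · intro j hj hjN
      simpa using hlen j hj hjN
    · constructor <;> intro t ht <;> exact absurd ht (Nat.not_lt_zero t)
    · constructor <;> intro t ht <;> exact absurd ht (Nat.not_lt_zero t)
    · intro x
      simp [ha]
    · simpa using h10
    · have e6 : ((s1.put 7 0 c.G.string.length).set 11 1).arr 6 0 = 0 := by simp [ha]
      have e7 : ((s1.put 7 0 c.G.string.length).set 11 1).arr 7 0 = c.G.string.length := by simp
      simp only [hlast, St.set_reg, if_true]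
      constructor
      · intro e he
        obtain rfl : e = 0 := by omega
        rw [e6, e7]; omega
      · intro e he
        obtain rfl : e = 0 := by omega
        rw [e7]; exact hN
      · intro e he
        obtain rfl : e = 0 := by omega
        rw [e6, e7, block, List.drop_zero, List.take_length]
        exact .root
      · exact fun _ _ t ht => absurd ht (Nat.not_lt_zero t)
      · intro e he e' he'
        omega
      · exact fun _ => ⟨e6, e7⟩
      · exact fun h => absurd h (by norm_num)
    · simp; omega
  · intro i s h
    refine ⟨by simp, fun h0 => (mainBody_spec hB h (by simpa using h0)).mono ?_⟩
    rintro k s' ⟨hk, h'⟩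
    exact ⟨by simp; omega, h'⟩
  · rintro j k2 s2 - ⟨hout, m, V, hI, hS, -⟩ h0 hk2
    simp at h0 hk2
    obtain ⟨hm, htop⟩ := hS.top h0
    have hmM := hI.gram.le_partCount
    refine (output_spec hB hout hI.count hmM).mono ?_
    rintro k3 s3 ⟨hk3, hout3⟩
    refine ⟨?_, m, V, s2.arr, hI.gram, hm, htop, hout3⟩
    have hX : partCount c.G.string * (partCount c.G.string * c.G.size ^ 3) =
        c.G.size ^ 3 * partCount c.G.string ^ 2 := by ring
    have hY : c.G.size ≤ partCount c.G.string * c.G.size ^ 3 :=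
      (Nat.le_self_pow (by norm_num) _).trans (Nat.le_mul_of_pos_left _ hM)
    have hMX : partCount c.G.string ≤ c.G.size ^ 3 * partCount c.G.string ^ 2 := by
      rw [← hX]
      exact Nat.le_mul_of_pos_right _ (by omega)
    have hYX : partCount c.G.string * c.G.size ^ 3 ≤ c.G.size ^ 3 * partCount c.G.string ^ 2 := by
      rw [← hX]
      exact Nat.le_mul_of_pos_left _ hM
    have hk := hk2.trans (Nat.add_le_add_right (Nat.mul_le_mul_right _ (Nat.sub_le _ 1)) _)
    -- Fewer than `2 * M` rounds of `16000 * M * n ^ 3` steps give the main term `32000`; the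
    -- remaining `1000` absorbs the lengths, the output and the tests.
    have hexp : 2 * partCount c.G.string * (16000 * (partCount c.G.string * c.G.size ^ 3) + 2) =
        32000 * (c.G.size ^ 3 * partCount c.G.string ^ 2) + 4 * partCount c.G.string := by
      rw [← hX]; ring
    rw [hexp] at hk
    omega

/-! ### The word size and the final theorem -/

/-- All quantities are at most cubic in `x = n + |S|`. As `x ≥ 2`, the generous exponents `12` and
`20` absorb the constants. -/
theorem size_add_length_bounds (G : SLP ℕ) :
    (partCount G.string + 1) * G.size + 4 * G.string.length + 4 * G.size +
      partCount G.string + 1000 ≤ (G.size + G.string.length) ^ 12 ∧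
    16 * (G.size + G.string.length) ^ 12 + 3 * G.size + 17 ≤ (G.size + G.string.length) ^ 20 := by
  have hn := G.size_pos
  have hN := string_length_pos (G := G)
  have hM := partCount_le G.string
  generalize partCount G.string = M at *
  generalize hx : G.size + G.string.length = x
  have h2 : 2 ≤ x := by omega
  have hM' : M ≤ x ^ 2 := hM.trans (Nat.pow_le_pow_left (by omega) 2)
  have h3 : (M + 1) * G.size ≤ (x ^ 2 + 1) * x := Nat.mul_le_mul (by omega) (by omega)
  have h4 : x ^ 2 ≤ x ^ 3 := Nat.pow_le_pow_right (by omega) (by norm_num)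
  have h5 : x ≤ x ^ 3 := Nat.le_self_pow (by norm_num) _
  have h6 : 2 ^ 3 ≤ x ^ 3 := Nat.pow_le_pow_left h2 3
  have h7 : x ^ 3 * 2 ^ 9 ≤ x ^ 12 := by
    rw [show x ^ 12 = x ^ 3 * x ^ 9 by ring]
    exact Nat.mul_le_mul_left _ (Nat.pow_le_pow_left h2 9)
  have h8 : x ^ 12 * 2 ^ 8 ≤ x ^ 20 := by
    rw [show x ^ 20 = x ^ 12 * x ^ 8 by ring]
    exact Nat.mul_le_mul_left _ (Nat.pow_le_pow_left h2 8)
  have h9 : (x ^ 2 + 1) * x = x ^ 3 + x := by ring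
  omega

end BisectionRAM

theorem theorem19 :
    ∃ (P : WordRAM.Program) (c C : ℕ), ∀ (w : ℕ) (G : SLP ℕ),
      (∀ (i : Fin G.size) (a : ℕ), G.rule i = .letter a → a < 2 ^ w) →
      (G.size + G.string.length) ^ c ≤ 2 ^ w →
      ∃ T : SLP ℕ, IsBisectionGrammar G.string T ∧
        WordRAM.ComputesWithin w P G.encode T.encode (C * (G.size ^ 3 * T.size ^ 2)) := by
  -- The exponent `20` lets words hold the addresses of arrays with indices up to `(n + |S|) ^ 12`,
  -- the bound chosen below.
  refine ⟨BisectionRAM.bisection.compile, 20, 33000, fun w G _ hw => ?_⟩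
  obtain ⟨hbig, hfits⟩ := BisectionRAM.size_add_length_bounds G
  let c : BisectionRAM.Ctx := ⟨G, w, (G.size + G.string.length) ^ 12, hfits.trans hw⟩
  obtain ⟨k, s, hexec, hk, m, V, a, hG, hm, htop, hout⟩ := BisectionRAM.bisection_spec (c := c) hbig
  have hT := hG.isBisectionGrammar hm htop
  refine ⟨hG.slp hm, hT, k, s.toState c, ?_, hk.trans ?_, hout.trans (hG.encode_slp hm).symm⟩
  · rw [← BisectionRAM.toState_init (c := c)]
    exact BisectionRAM.exec_compile hexec
  · exact Nat.mul_le_mul_left _ (Nat.mul_le_mul_left _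
      (Nat.pow_le_pow_left (BisectionRAM.partCount_le_size hT) 2))
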